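/- Let $F$ be an imaginary quadratic field with ring of integers $\mathcal{O}_F$, discriminant $D_F$ and ideal class group $\mathrm{Cl}_F$, and suppose $|\mathcal{O}_F^\times|=2$. Let $(V,Q)$ be a positive definite binary quadratic space over $\mathbb{Q}$, with symmetric bilinear form $B$ given by $2B(x,y)=Q(x+y)-Q(x)-Q(y)$, and let $L=\mathbb{Z}e_1+\mathbb{Z}e_2$ be a $\mathbb{Z}$-lattice on $V$ (that is, $e_1,e_2$ is a basis of $V$) with $Q(L)\subseteq\mathbb{Z}$ and $-4d_L=D_F$, where $d_L=\det(B(e_i,e_j))$. For $m\ge 1$ let $a_m^+(L)$ be the number of $O^+(V)$-equivalence classes of sublattices $K\subseteq L$ of index $m$, where $O^+(V)$ is the group of isometries of $V$ of determinant $1$ and $K_1,K_2$ are equivalent if $\sigma(K_1)=K_2$ for some $\sigma\in O^+(V)$. For a prime number $p$ put $$\zeta^+_{L,p}(s)=\sum_{i=0}^\infty a^+_{p^i}(L)\,p^{-is}.$$ Then for every prime $p$ and every $s\in\mathbb{C}$ with $\operatorname{Re}(s)>1$ this series converges absolutely, and: - if $p$ is inert or ramified in $F$, then $\zeta^+_{L,p}(s)=(1-p^{-s})^{-1}(1-p^{1-s})^{-1}$;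 - if $p$ is split in $F$, then $\zeta^+_{L,p}(s)=(1-p^{-k_ps})(1-p^{-s})^{-1}(1-p^{1-s})^{-1}$, where $k_p$ is the order of $[\mathfrak{p}]^2$ in $\mathrm{Cl}_F$ for a prime ideal $\mathfrak{p}$ of $\mathcal{O}_F$ above $p$ (either choice of $\mathfrak{p}$). -/

import Mathlib

/-- The Gram matrix `(B(e i, e j))` of a basis `e` of a quadratic space `(V, Q)`, where `B` is the
symmetric bilinear form with `2 B(x, y) = Q(x + y) - Q(x) - Q(y)`. -/
noncomputable def gramMatrix {V : Type*} [AddCommGroup V] [Module ℚ V] {n : ℕ}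
    (Q : QuadraticForm ℚ V) (e : Module.Basis (Fin n) ℚ V) : Matrix (Fin n) (Fin n) ℚ :=
  Matrix.of fun i j => QuadraticMap.associated Q (e i) (e j)

/-- The special orthogonal group `O⁺(V)` of a quadratic space `(V, Q)`. -/
def specialOrthogonal {V : Type*} [AddCommGroup V] [Module ℚ V] (Q : QuadraticForm ℚ V) :
    Subgroup (V ≃ₗ[ℚ] V) where
  carrier := {σ | (∀ x y, QuadraticMap.associated Q (σ x) (σ y) = QuadraticMap.associated Q x y) ∧
    LinearMap.det (σ : V →ₗ[ℚ] V) = 1}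
  one_mem' := ⟨fun _ _ => rfl, LinearMap.det_id⟩
  mul_mem' := by
    rintro σ τ ⟨hσ, hσ'⟩ ⟨hτ, hτ'⟩
    refine ⟨fun x y => ?_, ?_⟩
    · rw [LinearEquiv.mul_apply, LinearEquiv.mul_apply, hσ, hτ]
    · have h : ((σ * τ : V ≃ₗ[ℚ] V) : V →ₗ[ℚ] V) = (σ : V →ₗ[ℚ] V) * (τ : V →ₗ[ℚ] V) := rfl
      rw [h, map_mul, hσ', hτ', one_mul]
  inv_mem' := by
    rintro σ ⟨hσ, hσ'⟩
    refine ⟨fun x y => ?_, ?_⟩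
    · have h : ∀ z, σ (σ⁻¹ z) = z := fun z => σ.apply_symm_apply z
      rw [← hσ, h, h]
    · have h : ((σ⁻¹ : V ≃ₗ[ℚ] V) : V →ₗ[ℚ] V) * (σ : V →ₗ[ℚ] V) = 1 :=
        LinearMap.ext fun z => σ.symm_apply_apply z
      have h' := congrArg LinearMap.det h
      rwa [map_mul, hσ', mul_one, map_one] at h'

/-- The image `σ(K)` of a subgroup `K` of `V` under a `ℚ`-linear automorphism `σ` of `V`. -/
def latticeImage {V : Type*} [AddCommGroup V] [Module ℚ V] (σ : V ≃ₗ[ℚ] V)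
    (K : Submodule ℤ V) : Submodule ℤ V :=
  K.map ((σ : V →ₗ[ℚ] V).restrictScalars ℤ)

/-- The set of `ℤ`-sublattices of `L` of index `m` (for `m ≥ 1`). -/
def sublatticesOfIndex {V : Type*} [AddCommGroup V] (L : Submodule ℤ V) (m : ℕ) :
    Set (Submodule ℤ V) :=
  {K | K ≤ L ∧ K.toAddSubgroup.relIndex L.toAddSubgroup = m}

/-- Proper isometry (`O⁺(V)`-equivalence) on the sublattices of `L` of index `m`. -/
def properIsometrySetoid {V : Type*} [AddCommGroup V] [Module ℚ V] (Q : QuadraticForm ℚ V)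
    (L : Submodule ℤ V) (m : ℕ) : Setoid (sublatticesOfIndex L m) where
  r K₁ K₂ := ∃ σ ∈ specialOrthogonal Q, latticeImage σ K₁.1 = K₂.1
  iseqv :=
    { refl := fun K => ⟨1, one_mem _, Submodule.map_id K.1⟩
      symm := by
        rintro K₁ K₂ ⟨σ, hσ, h⟩
        refine ⟨σ⁻¹, inv_mem hσ, ?_⟩
        rw [← h, latticeImage, latticeImage, ← Submodule.map_comp]
        convert Submodule.map_id K₁.1 using 2
        exact LinearMap.ext fun z => σ.symm_apply_apply z
      trans := by
        rintro K₁ K₂ K₃ ⟨σ, hσ, h⟩ ⟨τ, hτ, h'⟩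
        refine ⟨τ * σ, mul_mem hτ hσ, ?_⟩
        rw [← h', ← h, latticeImage, latticeImage, latticeImage, ← Submodule.map_comp]
        rfl }

/-- `a_m⁺(L)`: the number of proper isometry classes of sublattices of `L` of index `m`. -/
noncomputable def properClassCount {V : Type*} [AddCommGroup V] [Module ℚ V]
    (Q : QuadraticForm ℚ V) (L : Submodule ℤ V) (m : ℕ) : ℕ :=
  Nat.card (Quotient (properIsometrySetoid Q L m))

/-- The `i`-th term `a_{p^i}⁺(L) p^{-is}` of the local Dirichlet series at `p`. -/
noncomputable def properLocalTerm {V : Type*} [AddCommGroup V] [Module ℚ V]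
    (Q : QuadraticForm ℚ V) (L : Submodule ℤ V) (p : ℕ) (s : ℂ) (i : ℕ) : ℂ :=
  (properClassCount Q L (p ^ i) : ℂ) * (p : ℂ) ^ (-((i : ℂ) * s))

/-- The local zeta function `ζ⁺_{L,p}(s) = ∑_{i ≥ 0} a_{p^i}⁺(L) p^{-is}`. -/
noncomputable def properLocalZeta {V : Type*} [AddCommGroup V] [Module ℚ V]
    (Q : QuadraticForm ℚ V) (L : Submodule ℤ V) (p : ℕ) (s : ℂ) : ℂ :=
  ∑' i : ℕ, properLocalTerm Q L p s i

/-- `p` is inert in the quadratic field `F`: `(p)` is a prime ideal of `𝓞 F`. -/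
def IsInertIn (F : Type*) [Field F] (p : ℕ) : Prop :=
  (Ideal.span {(p : NumberField.RingOfIntegers F)}).IsPrime

/-- `p` is ramified in the quadratic field `F`: `(p)` is the square of a prime ideal of `𝓞 F`. -/
def IsRamifiedIn (F : Type*) [Field F] (p : ℕ) : Prop :=
  ∃ 𝔭 : Ideal (NumberField.RingOfIntegers F), 𝔭.IsPrime ∧
    Ideal.span {(p : NumberField.RingOfIntegers F)} = 𝔭 ^ 2

/-- `p` is split in the quadratic field `F`: `(p)` is the product of two distinct prime ideals
of `𝓞 F`. -/
def IsSplitIn (F : Type*) [Field F] (p : ℕ) : Prop :=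
  ∃ 𝔭 𝔮 : Ideal (NumberField.RingOfIntegers F), 𝔭.IsPrime ∧ 𝔮.IsPrime ∧ 𝔭 ≠ 𝔮 ∧
    Ideal.span {(p : NumberField.RingOfIntegers F)} = 𝔭 * 𝔮

/-! Write the form as `ax² + bxy + cy²`, so that `b² - 4ac` is the discriminant of `F` and `𝓞 F = ℤ
+ ℤω` with `ω² = bω - ac`. Sending `e 0` to `a` and `e 1` to `ω` turns `aQ` into the norm of `F`,
`L` into the ideal `I = ℤa + ℤω`, and proper isometries into multiplications by elements `u` of norm
`1`. The task is therefore to count subgroups of `I` of index `p^i` modulo such `u`.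

Without the equivalence there are `1 + p + ... + p^i` of them, with generating function `(1 - x)⁻¹
(1 - px)⁻¹`, `x = p^(-s)`. If `u` carries one subgroup of index `p^i` to another, then `p^i u` and
`p^i u⁻¹` stabilise `I`, hence are integral, so only primes above `p` occur in `(u)`. If just one
prime lies above `p`, the norm condition makes `u` a unit, so `u = ±1` and nothing is identified.

If `(p) = 𝔭𝔮` splits, then `(u) = (𝔭/𝔮)^n`. Since `𝔭/𝔮` has class `[𝔭]²`, such `u` are, up to sign,
powers of one `τ` with `(τ) = (𝔭/𝔮)^k`, where `k` is the order of `[𝔭]²`. Each orbit of `τ` meets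
the subgroups of index `p^i` in a finite interval, so the number of classes is the number of
subgroups minus the number of those `K` whose translate `τK` is still among them. This last
condition says `K ⊆ I ∩ τ⁻¹I = 𝔮^k I`, so those `K` are the subgroups of index `p^(i-k)` in another
ideal. Subtracting the count delayed by `k` gives the factor `1 - x^k`. -/

/-! ### Counting classes of a permutation restricted to a finite set -/

/-- Orbit counting for a permutation `t` all of whose orbits meet the finite set `S` in an
interval: the classes are in bijection with the last elements of these intervals. -/
theorem card_quotient_add_ncard_eq {X : Type*} (t : Equiv.Perm X) (S : Set X) (hS : S.Finite)
    (r : Setoid S) (hr : ∀ x y : S, r x y ↔ ∃ n : ℤ, (t ^ n) (x : X) = y)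
    (hconv : ∀ x ∈ S, ∀ n : ℕ, 1 ≤ n → (t ^ n) x ∈ S → t x ∈ S)
    (hesc : ∀ x ∈ S, ∃ n : ℕ, (t ^ n) x ∉ S) :
    Nat.card (Quotient r) + {x ∈ S | t x ∈ S}.ncard = S.ncard := by
  -- `T` consists of the points where an orbit leaves `S`; by `hconv` it never returns, so each
  -- class contains exactly one of them.
  let T : Set X := {x ∈ S | t x ∉ S}
  have hforward : ∀ x ∈ T, ∀ y ∈ S, ∀ n : ℕ, (t ^ n) x = y → x = y := by
    intro x hx y hy n h
    rcases Nat.eq_zero_or_pos n with rfl | hn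
    · simpa using h
    · exact absurd (hconv x hx.1 n hn (h ▸ hy)) hx.2
  have hbij : Function.Bijective (fun x : T => (Quotient.mk r ⟨x.1, x.2.1⟩)) := by
    constructor
    · rintro ⟨x, hx⟩ ⟨y, hy⟩ h
      have h' := (hr _ _).1 (Quotient.exact h)
      obtain ⟨n, hn⟩ := h'
      simp only at hn
      apply Subtype.ext
      obtain ⟨m, rfl | rfl⟩ := n.eq_nat_or_neg
      · exact hforward x hx y hy.1 m (by simpa using hn)
      · refine (hforward y hy x hx.1 m ?_).symm
        rw [← hn, zpow_neg, zpow_natCast]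
        exact Equiv.apply_symm_apply _ _
    · intro q
      induction q using Quotient.inductionOn with | _ x => ?_
      obtain ⟨x, hx⟩ := x
      classical
      have hex := hesc x hx
      have hmem : ∀ n < Nat.find hex, (t ^ n) x ∈ S := fun n hn => not_not.1 (Nat.find_min hex hn)
      have hpos : Nat.find hex ≠ 0 := fun h => by
        have := Nat.find_spec hex
        rw [h] at this
        exact this hx
      obtain ⟨N, hN⟩ := Nat.exists_eq_succ_of_ne_zero hpos
      have h1 : (t ^ N) x ∈ S := hmem N (by omega)
      have h2 : t ((t ^ N) x) ∉ S := by
        have := Nat.find_spec hex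
        rwa [hN, Nat.succ_eq_add_one, pow_succ', Equiv.Perm.mul_apply] at this
      refine ⟨⟨(t ^ N) x, h1, h2⟩, Quotient.sound (Setoid.symm' _ ((hr _ _).2 ⟨N, ?_⟩))⟩
      simp
  have h1 : Nat.card (Quotient r) = T.ncard := (Nat.card_eq_of_bijective _ hbij).symm
  have h2 : T = S \ {x ∈ S | t x ∈ S} := by
    ext x
    simp only [T, Set.mem_ofPred_eq, Set.mem_sdiff, not_and]
    tauto
  rw [h1, h2]
  exact Set.ncard_sdiff_add_ncard_of_subset (fun x hx => hx.1) hS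

theorem card_quotient_of_trivial {X : Type*} (r : Setoid X) (h : ∀ x y, r x y → x = y) :
    Nat.card (Quotient r) = Nat.card X :=
  (Nat.card_eq_of_bijective (Quotient.mk r)
    ⟨fun x y hxy => h x y (Quotient.exact hxy), Quotient.mk_surjective⟩).symm

/-! ### Finite-index subgroups of `ℤ²` via Hermite normal form -/

/-- The subgroup of `ℤ × ℤ` generated by `(c, 0)` and `(b, d)`. -/
def hermiteSubgroup (c d b : ℕ) : AddSubgroup (ℤ × ℤ) where
  carrier := {x | ∃ j k : ℤ, x = (b * j + c * k, d * j)}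
  zero_mem' := ⟨0, 0, by ext <;> simp⟩
  add_mem' := by
    rintro _ _ ⟨j, k, rfl⟩ ⟨j', k', rfl⟩
    exact ⟨j + j', k + k', by ext <;> simp <;> ring⟩
  neg_mem' := by
    rintro _ ⟨j, k, rfl⟩
    exact ⟨-j, -k, by ext <;> simp; ring⟩

theorem mem_hermiteSubgroup {c d b : ℕ} {x : ℤ × ℤ} :
    x ∈ hermiteSubgroup c d b ↔ ∃ j k : ℤ, x = (b * j + c * k, d * j) := Iff.rfl

/-- Factor the index through `K + ker snd`: the upper step is seen in the projection, the lower one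
in the intersection with `ℤ × 0`. -/
theorem index_eq_comap_inl_mul_map_snd (K : AddSubgroup (ℤ × ℤ)) :
    K.index = (K.comap (AddMonoidHom.inl ℤ ℤ)).index * (K.map (AddMonoidHom.snd ℤ ℤ)).index := by
  have hker : (AddMonoidHom.snd ℤ ℤ).ker = (⊤ : AddSubgroup ℤ).map (AddMonoidHom.inl ℤ ℤ) := by
    ext ⟨x, y⟩
    simp [AddSubgroup.mem_prod, eq_comm]
  have h1 : (K.map (AddMonoidHom.snd ℤ ℤ)).index = (K ⊔ (AddMonoidHom.snd ℤ ℤ).ker).index := by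
    rw [AddSubgroup.index_map, AddMonoidHom.range_eq_top.2 Prod.snd_surjective,
      AddSubgroup.index_top, mul_one]
  have h2 : (K.comap (AddMonoidHom.inl ℤ ℤ)).index =
      K.relIndex (K ⊔ (AddMonoidHom.snd ℤ ℤ).ker) := by
    rw [AddSubgroup.relIndex_sup_left, hker, ← AddSubgroup.relIndex_comap,
      AddSubgroup.relIndex_top_right]
  rw [h1, h2, AddSubgroup.relIndex_mul_index le_sup_left]

theorem comap_inl_hermiteSubgroup {c d b : ℕ} (hd : d ≠ 0) :
    (hermiteSubgroup c d b).comap (AddMonoidHom.inl ℤ ℤ) = AddSubgroup.zmultiples (c : ℤ) := by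
  ext x
  simp only [AddSubgroup.mem_comap, AddMonoidHom.inl_apply, mem_hermiteSubgroup, Prod.mk.injEq,
    Int.mem_zmultiples_iff]
  constructor
  · rintro ⟨j, k, h, h'⟩
    have : j = 0 := by
      have : (d : ℤ) ≠ 0 := by exact_mod_cast hd
      exact (mul_eq_zero.1 h'.symm).resolve_left this
    exact ⟨k, by simpa [this] using h⟩
  · rintro ⟨k, rfl⟩
    exact ⟨0, k, by simp⟩

theorem map_snd_hermiteSubgroup {c d b : ℕ} :
    (hermiteSubgroup c d b).map (AddMonoidHom.snd ℤ ℤ) = AddSubgroup.zmultiples (d : ℤ) := by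
  ext x
  simp only [AddSubgroup.mem_map, mem_hermiteSubgroup, Int.mem_zmultiples_iff]
  constructor
  · rintro ⟨_, ⟨j, k, rfl⟩, rfl⟩
    exact ⟨j, rfl⟩
  · rintro ⟨j, rfl⟩
    exact ⟨(b * j, d * j), ⟨j, 0, by simp⟩, rfl⟩

theorem index_hermiteSubgroup {c d b : ℕ} (hd : d ≠ 0) : (hermiteSubgroup c d b).index = c * d := by
  rw [index_eq_comap_inl_mul_map_snd, comap_inl_hermiteSubgroup hd, map_snd_hermiteSubgroup]
  simp

/-- Here `c` generates the intersection with `ℤ × 0`, `d` generates the second projection, and `b`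
is the first coordinate of a lift of `d`, reduced modulo `c`. -/
theorem exists_eq_hermiteSubgroup (K : AddSubgroup (ℤ × ℤ)) (hK : K.index ≠ 0) :
    ∃ c d b : ℕ, c * d = K.index ∧ b < c ∧ K = hermiteSubgroup c d b := by
  have hcyc : ∀ H : AddSubgroup ℤ, H = AddSubgroup.zmultiples (H.index : ℤ) := by
    intro H
    obtain ⟨a, rfl⟩ := Int.subgroup_cyclic H
    rw [← AddSubgroup.zmultiples_eq_closure, Int.index_zmultiples]
    simp
  set c := (K.comap (AddMonoidHom.inl ℤ ℤ)).index with hc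
  set d := (K.map (AddMonoidHom.snd ℤ ℤ)).index with hd
  have hcd : K.index = c * d := index_eq_comap_inl_mul_map_snd K
  have hcpos : 0 < c := Nat.pos_of_ne_zero fun h => hK (by rw [hcd, h, zero_mul])
  have hmemc : ∀ x : ℤ, (x, (0 : ℤ)) ∈ K ↔ (c : ℤ) ∣ x := by
    intro x
    rw [← Int.mem_zmultiples_iff, hc, ← hcyc]
    rfl
  have hmemd : ∀ y : ℤ, (∃ x : ℤ, (x, y) ∈ K) ↔ (d : ℤ) ∣ y := by
    intro y
    rw [← Int.mem_zmultiples_iff, hd, ← hcyc]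
    simp
  obtain ⟨x₀, hx₀⟩ := (hmemd d).2 dvd_rfl
  have hc0 : (c : ℤ) ≠ 0 := by exact_mod_cast hcpos.ne'
  have hb : ((x₀ % c).toNat : ℤ) = x₀ % c := Int.toNat_of_nonneg (Int.emod_nonneg _ hc0)
  have hbK : ((x₀ % c, (d : ℤ)) : ℤ × ℤ) ∈ K := by
    have h1 : ((c * (x₀ / c), (0 : ℤ)) : ℤ × ℤ) ∈ K := (hmemc _).2 ⟨_, rfl⟩
    have := K.sub_mem hx₀ h1
    rwa [Prod.mk_sub_mk, sub_zero, ← Int.emod_def] at this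
  have hbj : ∀ j : ℤ, ((x₀ % c) * j, (d : ℤ) * j) ∈ K := fun j => by
    have := K.zsmul_mem hbK j
    rwa [Prod.smul_mk, smul_eq_mul, smul_eq_mul, mul_comm j, mul_comm j] at this
  refine ⟨c, d, (x₀ % c).toNat, hcd.symm, ?_, ?_⟩
  · have := Int.emod_lt_of_pos x₀ (show (0 : ℤ) < c by exact_mod_cast hcpos)
    omega
  · ext ⟨x, y⟩
    rw [mem_hermiteSubgroup, hb]
    constructor
    · intro h
      obtain ⟨j, rfl⟩ := (hmemd y).1 ⟨x, h⟩
      have := K.sub_mem h (hbj j)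
      rw [Prod.mk_sub_mk, sub_self, hmemc] at this
      obtain ⟨k, hk⟩ := this
      exact ⟨j, k, by rw [← hk]; simp⟩
    · rintro ⟨j, k, h⟩
      have := K.add_mem (hbj j) ((hmemc (c * k)).2 ⟨k, rfl⟩)
      rwa [Prod.mk_add_mk, add_zero, ← h] at this

theorem hermiteSubgroup_injective {c d b c' d' b' : ℕ} (hd : d ≠ 0) (hd' : d' ≠ 0) (hb : b < c)
    (hb' : b' < c') (h : hermiteSubgroup c d b = hermiteSubgroup c' d' b') : c = c' ∧ b = b' := by
  have h1 : c = c' := by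
    have := comap_inl_hermiteSubgroup (c := c) (b := b) hd
    rw [h, comap_inl_hermiteSubgroup hd'] at this
    simpa using (congrArg AddSubgroup.index this).symm
  have h2 : d = d' := by
    have := map_snd_hermiteSubgroup (c := c) (d := d) (b := b)
    rw [h, map_snd_hermiteSubgroup] at this
    simpa using (congrArg AddSubgroup.index this).symm
  subst h1 h2
  refine ⟨rfl, ?_⟩
  have hmem : ((b : ℤ), (d : ℤ)) ∈ hermiteSubgroup c d b' := h ▸ ⟨1, 0, by simp⟩
  obtain ⟨j, k, hjk⟩ := hmem
  rw [Prod.mk.injEq] at hjk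
  have hj : j = 1 := by
    have : (d : ℤ) ≠ 0 := by exact_mod_cast hd
    exact mul_left_cancel₀ this (by rw [← hjk.2, mul_one])
  have hmod : b ≡ b' [MOD c] := by
    rw [← Int.natCast_modEq_iff, hjk.1, hj, mul_one]
    simp [Int.ModEq]
  rwa [Nat.ModEq, Nat.mod_eq_of_lt hb, Nat.mod_eq_of_lt hb'] at hmod

theorem bijOn_hermiteSubgroup {m : ℕ} (hm : m ≠ 0) :
    Set.BijOn (fun x : (_ : ℕ) × ℕ => hermiteSubgroup x.1 (m / x.1) x.2)
      (m.divisors.sigma fun c => Finset.range c) {K | K.index = m} := by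
  have hdiv : ∀ c ∈ m.divisors, m / c ≠ 0 := fun c hc =>
    (Nat.div_pos (Nat.divisor_le hc) (Nat.pos_of_mem_divisors hc)).ne'
  refine ⟨?_, ?_, ?_⟩
  · rintro ⟨c, b⟩ h
    simp only [Finset.coe_sigma, Set.mem_sigma_iff, Finset.mem_coe, Finset.mem_range] at h
    rw [Set.mem_ofPred_eq, index_hermiteSubgroup (hdiv c h.1),
      Nat.mul_div_cancel' (Nat.dvd_of_mem_divisors h.1)]
  · rintro ⟨c, b⟩ h ⟨c', b'⟩ h' heq
    simp only [Finset.coe_sigma, Set.mem_sigma_iff, Finset.mem_coe, Finset.mem_range] at h h'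
    obtain ⟨rfl, rfl⟩ := hermiteSubgroup_injective (hdiv c h.1) (hdiv c' h'.1) h.2 h'.2 heq
    rfl
  · intro K hK
    obtain ⟨c, d, b, hcd, hbc, rfl⟩ := exists_eq_hermiteSubgroup K (hK ▸ hm)
    rw [Set.mem_ofPred_eq] at hK
    rw [hK] at hcd
    refine ⟨⟨c, b⟩, ?_, ?_⟩
    · simp only [Finset.coe_sigma, Set.mem_sigma_iff, Finset.mem_coe, Finset.mem_range]
      exact ⟨Nat.mem_divisors.2 ⟨⟨d, hcd.symm⟩, hm⟩, hbc⟩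
    · simp only [← hcd, Nat.mul_div_cancel_left d (show 0 < c by omega)]

theorem finite_setOf_index_eq {m : ℕ} (hm : m ≠ 0) :
    {K : AddSubgroup (ℤ × ℤ) | K.index = m}.Finite :=
  (bijOn_hermiteSubgroup hm).finite_iff_finite.1 (Finset.finite_toSet _)

theorem ncard_setOf_index_eq {m : ℕ} (hm : m ≠ 0) :
    {K : AddSubgroup (ℤ × ℤ) | K.index = m}.ncard = ∑ c ∈ m.divisors, c := by
  rw [← (bijOn_hermiteSubgroup hm).image_eq, 
    (bijOn_hermiteSubgroup hm).injOn.ncard_image, Set.ncard_coe_finset, Finset.card_sigma]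
  simp

/-- The subgroups of `A` of index `m`. -/
def subgroupsOfRelIndex {G : Type*} [AddGroup G] (A : AddSubgroup G) (m : ℕ) :
    Set (AddSubgroup G) :=
  {K | K ≤ A ∧ K.relIndex A = m}

theorem bijOn_subgroupsOfRelIndex {G : Type*} [AddGroup G] (A : AddSubgroup G)
    (f : ℤ × ℤ →+ G) (hf : Function.Injective f) (hA : f.range = A) (m : ℕ) :
    Set.BijOn (AddSubgroup.map f) {K | K.index = m} (subgroupsOfRelIndex A m) := by
  subst hA
  refine ⟨?_, (AddSubgroup.map_injective hf).injOn, ?_⟩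
  · intro K hK
    refine ⟨AddSubgroup.map_le_range f K, ?_⟩
    rw [AddMonoidHom.range_eq_map, AddSubgroup.relIndex_map_map_of_injective _ _ hf,
      AddSubgroup.relIndex_top_right]
    exact hK
  · rintro K ⟨hK, hK'⟩
    refine ⟨K.comap f, ?_, AddSubgroup.map_comap_eq_self hK⟩
    rwa [Set.mem_ofPred_eq, ← AddSubgroup.relIndex_top_right, AddSubgroup.relIndex_comap,
      ← AddMonoidHom.range_eq_map]

/-! ### Generating functions -/

theorem sum_mul_geom_eq (x q : ℂ) (n : ℕ) :
    ∑ k ∈ Finset.range (n + 1), (q * x) ^ k * x ^ (n - k) =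
      (∑ k ∈ Finset.range (n + 1), q ^ k) * x ^ n := by
  rw [Finset.sum_mul]
  refine Finset.sum_congr rfl fun k hk => ?_
  rw [mul_pow, mul_assoc, ← pow_add, Nat.add_sub_cancel' (by simpa [Nat.lt_succ_iff] using hk)]

theorem summable_norm_geom_sum_mul_pow {x q : ℂ} (hx : ‖x‖ < 1) (hqx : ‖q * x‖ < 1) :
    Summable fun n : ℕ => ‖(∑ k ∈ Finset.range (n + 1), q ^ k) * x ^ n‖ := by
  refine Summable.congr ?_ fun n => congrArg norm (sum_mul_geom_eq x q n)
  exact summable_norm_sum_mul_range_of_summable_norm (summable_norm_geometric_of_norm_lt_one hqx)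
    (summable_norm_geometric_of_norm_lt_one hx)

theorem hasSum_geom_sum_mul_pow {x q : ℂ} (hx : ‖x‖ < 1) (hqx : ‖q * x‖ < 1) :
    HasSum (fun n : ℕ => (∑ k ∈ Finset.range (n + 1), q ^ k) * x ^ n)
      ((1 - x)⁻¹ * (1 - q * x)⁻¹) := by
  have hs := (summable_norm_geom_sum_mul_pow hx hqx).of_norm
  rw [show (1 - x)⁻¹ * (1 - q * x)⁻¹ =
      ∑' n : ℕ, (∑ k ∈ Finset.range (n + 1), q ^ k) * x ^ n from ?_]
  · exact hs.hasSum
  rw [← tsum_congr (sum_mul_geom_eq x q), ← tsum_mul_tsum_eq_tsum_sum_range_of_summable_norm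
    (summable_norm_geometric_of_norm_lt_one hqx) (summable_norm_geometric_of_norm_lt_one hx),
    tsum_geometric_of_norm_lt_one hqx, tsum_geometric_of_norm_lt_one hx, mul_comm]

/-- Delaying the coefficients by `k` multiplies the series by `x^k`. This is the source of the extra
factor at split primes. -/
theorem hasSum_sub_shift {a b : ℕ → ℂ} {x S : ℂ} (k : ℕ)
    (ha : HasSum (fun n => a n * x ^ n) S)
    (hb : ∀ n, b n = a n - if k ≤ n then a (n - k) else 0) :
    HasSum (fun n => b n * x ^ n) ((1 - x ^ k) * S) := by
  have h1 : HasSum (fun n => (if k ≤ n then a (n - k) else 0) * x ^ n) (x ^ k * S) := by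
    refine ((add_left_injective k).hasSum_iff ?_).1 ?_
    · intro n hn
      have : ¬ k ≤ n := fun h => hn ⟨n - k, Nat.sub_add_cancel h⟩
      simp [this]
    · refine (ha.mul_left (x ^ k)).congr_fun fun n => ?_
      simp only [Function.comp_apply, Nat.le_add_left, if_true, Nat.add_sub_cancel, pow_add]
      ring
  have h2 := ha.sub h1
  rw [show S - x ^ k * S = (1 - x ^ k) * S by ring] at h2
  exact h2.congr_fun fun n => by rw [hb, sub_mul]

/-! ### Integral bases and norm forms of quadratic fields -/

open NumberField in
/-- A quadratic ring of integers has a `ℤ`-basis containing `1`. -/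
theorem exists_basis_ringOfIntegers_one {F : Type*} [Field F] [NumberField F]
    [Algebra.IsQuadraticExtension ℚ F] :
    ∃ B : Module.Basis (Fin 2) ℤ (𝓞 F), B 0 = 1 := by
  have hrank : Module.finrank ℤ (𝓞 F) = 2 := by
    rw [RingOfIntegers.rank, Algebra.IsQuadraticExtension.finrank_eq_two]
  let w : Module.Basis (Fin 2) ℤ (𝓞 F) := Module.finBasisOfFinrankEq ℤ (𝓞 F) hrank
  have hw : ∀ x : 𝓞 F, x = w.repr x 0 • w 0 + w.repr x 1 • w 1 := fun x => by
    conv_lhs => rw [← w.sum_repr x, Fin.sum_univ_two]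
  have hw1 := hw 1
  set m := w.repr 1 0
  set n := w.repr 1 1
  -- A common divisor `g` of the coordinates of `1` is a unit of `𝓞 F`, so its norm `g²` is a unit
  -- of `ℤ`. Bézout then completes `(m, n)` to a unimodular matrix whose second row is `θ`.
  have hcop : IsCoprime m n := by
    rw [← isRelPrime_iff_isCoprime]
    rintro g ⟨m', hm⟩ ⟨n', hn⟩
    have hg : algebraMap ℤ (𝓞 F) g * (m' • w 0 + n' • w 1) = 1 := by
      rw [hw1, hm, hn, ← Algebra.smul_def, smul_add, smul_smul, smul_smul]
    have h1 : IsUnit (Algebra.norm ℤ (algebraMap ℤ (𝓞 F) g)) :=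
      (IsUnit.of_mul_eq_one _ hg).map _
    rw [Algebra.norm_algebraMap_of_basis w, Fintype.card_fin] at h1
    exact (isUnit_pow_iff two_ne_zero).1 h1
  obtain ⟨t, s, hts⟩ := hcop
  set θ : 𝓞 F := (-s) • w 0 + t • w 1 with hθ
  have h0 : w 0 = t • (1 : 𝓞 F) + (-n) • θ := by
    have : t • (1 : 𝓞 F) + (-n) • θ = (t * m + s * n) • w 0 := by
      rw [hw1, hθ]
      module
    rw [this, hts, one_smul]
  have h1 : w 1 = s • (1 : 𝓞 F) + m • θ := by
    have : s • (1 : 𝓞 F) + m • θ = (t * m + s * n) • w 1 := by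
      rw [hw1, hθ]
      module
    rw [this, hts, one_smul]
  have hspan : ⊤ ≤ Submodule.span ℤ (Set.range ![(1 : 𝓞 F), θ]) := by
    rintro x -
    have hone : (1 : 𝓞 F) ∈ Submodule.span ℤ (Set.range ![(1 : 𝓞 F), θ]) :=
      Submodule.subset_span ⟨0, rfl⟩
    have hthe : θ ∈ Submodule.span ℤ (Set.range ![(1 : 𝓞 F), θ]) :=
      Submodule.subset_span ⟨1, rfl⟩
    rw [hw x, h0, h1]
    refine add_mem (Submodule.smul_mem _ _ (add_mem ?_ ?_)) (Submodule.smul_mem _ _ (add_mem ?_ ?_))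
    all_goals exact Submodule.smul_mem _ _ ‹_›
  have hli : LinearIndependent ℤ ![(1 : 𝓞 F), θ] := by
    rw [LinearIndependent.pair_iff]
    intro x y hxy
    have hz : (x * m - y * s) • w 0 + (x * n + y * t) • w 1 = 0 := by
      rw [← hxy, hθ, hw1]
      module
    have hw' : ![w 0, w 1] = w := by
      ext i
      fin_cases i <;> rfl
    have hz' := LinearIndependent.pair_iff.1 (hw' ▸ w.linearIndependent) _ _ hz
    constructor
    · linear_combination t * hz'.1 + s * hz'.2 - x * hts
    · linear_combination m * hz'.2 - n * hz'.1 - y * hts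
  exact ⟨Module.Basis.mk hli hspan, by simp⟩

theorem trace_of_basis_one {R S : Type*} [CommRing R] [CommRing S] [Algebra R S]
    (B : Module.Basis (Fin 2) R S) (h0 : B 0 = 1) {T N : R}
    (h1 : B 1 * B 1 = T • B 1 - N • 1) (x y : R) :
    Algebra.trace R S (x • 1 + y • B 1) = 2 * x + T * y ∧
      Algebra.norm R (x • 1 + y • B 1) = x ^ 2 + T * x * y + N * y ^ 2 := by
  have hA : Algebra.leftMulMatrix B (x • 1 + y • B 1) = !![x, -(N * y); y, x + T * y] := by
    ext i j
    rw [Algebra.leftMulMatrix_eq_repr_mul]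
    have e0 : (x • 1 + y • B 1) * B 0 = x • B 0 + y • B 1 := by rw [h0, mul_one]
    have e1 : (x • 1 + y • B 1) * B 1 = (-(N * y)) • B 0 + (x + T * y) • B 1 := by
      rw [add_mul, smul_mul_assoc, smul_mul_assoc, one_mul, h1, h0]
      module
    fin_cases j
    · simp only [Fin.zero_eta, e0, map_add, map_smul, Module.Basis.repr_self]
      fin_cases i <;> simp
    · simp only [Fin.mk_one, e1, map_add, map_smul, Module.Basis.repr_self]
      fin_cases i <;> simp
  rw [Algebra.trace_eq_matrix_trace B, Algebra.norm_eq_matrix_det B, hA, Matrix.trace_fin_two,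
    Matrix.det_fin_two]
  simp only [Matrix.of_apply, Matrix.cons_val', Matrix.cons_val_zero, Matrix.cons_val_one,
    Matrix.cons_val_fin_one]
  constructor <;> ring

open NumberField in
/-- If `b² - 4n` is the discriminant of the quadratic field `F`, then `𝓞 F = ℤ + ℤω` for a root
`ω` of `X² - bX + n`. -/
theorem exists_generator_ringOfIntegers {F : Type*} [Field F] [NumberField F]
    [Algebra.IsQuadraticExtension ℚ F] {b n : ℤ} (h : b ^ 2 - 4 * n = discr F) :
    ∃ ω : 𝓞 F, ω * ω = b • ω - n • 1 ∧ ∀ x : 𝓞 F, ∃ k l : ℤ, x = k • 1 + l • ω := by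
  obtain ⟨B, hB⟩ := exists_basis_ringOfIntegers_one (F := F)
  have hrep : ∀ x : 𝓞 F, x = B.repr x 0 • 1 + B.repr x 1 • B 1 := fun x => by
    conv_lhs => rw [← B.sum_repr x, Fin.sum_univ_two, hB]
  obtain ⟨T, N, hTN⟩ : ∃ T N : ℤ, B 1 * B 1 = T • B 1 - N • 1 :=
    ⟨B.repr (B 1 * B 1) 1, -B.repr (B 1 * B 1) 0, by
      conv_lhs => rw [hrep (B 1 * B 1)]
      module⟩
  have htr := fun x y => (trace_of_basis_one B hB hTN x y).1
  have hd : discr F = T ^ 2 - 4 * N := by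
    rw [← NumberField.discr_eq_discr F B, Algebra.discr_def, Matrix.det_fin_two]
    simp only [Algebra.traceMatrix_apply, Algebra.traceForm_apply, hB]
    have e0 := htr 1 0
    have e1 := htr 0 1
    have e2 := htr (-N) T
    rw [show (-N) • (1 : 𝓞 F) + T • B 1 = B 1 * B 1 by rw [hTN]; module] at e2
    simp only [one_smul, zero_smul, add_zero, zero_add] at e0 e1
    rw [mul_one, mul_one, one_mul, e0, e1, e2]
    ring
  -- Equal discriminants force `b` and `T` to have the same parity, so translating `B 1` by the
  -- integer `g` produces a root with trace `b`.
  obtain ⟨g, hg⟩ : ∃ g : ℤ, b = T + 2 * g := by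
    have h2 : (2 : ℤ) ∣ (b - T) * (b + T) := ⟨2 * (n - N), by linear_combination h + hd⟩
    have h3 : (2 : ℤ) ∣ b - T := by
      rcases Int.prime_two.dvd_or_dvd h2 with h | h
      · exact h
      · omega
    obtain ⟨g, hg⟩ := h3
    exact ⟨g, by omega⟩
  have hn : n = N + T * g + g ^ 2 := by
    have : 4 * n = 4 * (N + T * g + g ^ 2) := by
      rw [hg] at h
      linear_combination -hd - h
    omega
  refine ⟨B 1 + g • 1, ?_, fun x => ⟨B.repr x 0 - g * B.repr x 1, B.repr x 1, ?_⟩⟩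
  · rw [hg, hn, add_mul, mul_add, hTN]
    simp only [smul_mul_assoc, mul_smul_comm, one_mul, mul_one]
    module
  · conv_lhs => rw [hrep x]
    module

open NumberField in
/-- A `ℤ`-generator of the quadratic ring of integers gives a `ℚ`-basis of the field. -/
theorem exists_basis_of_generator {F : Type*} [Field F] [NumberField F]
    [Algebra.IsQuadraticExtension ℚ F] {ω : 𝓞 F}
    (h : ∀ x : 𝓞 F, ∃ k l : ℤ, x = k • 1 + l • ω) :
    ∃ B : Module.Basis (Fin 2) ℚ F, B 0 = 1 ∧ B 1 = ω := by
  have hspan : ⊤ ≤ Submodule.span ℚ (Set.range ![(1 : F), ω]) := by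
    rintro z -
    have hz : IsAlgebraic ℤ z := (IsFractionRing.isAlgebraic_iff ℤ ℚ F).2 (.of_finite ℚ z)
    obtain ⟨d, hd, hdz⟩ := hz.exists_integral_multiple
    obtain ⟨k, l, hkl⟩ := h ⟨d • z, hdz⟩
    have hd' : (d : ℚ) ≠ 0 := by exact_mod_cast hd
    have hF : d • z = k • (1 : F) + l • (ω : F) := by
      have := congrArg (fun x : 𝓞 F => (x : F)) hkl
      simpa using this
    have hzeq : z = ((d : ℚ)⁻¹ * k) • (1 : F) + ((d : ℚ)⁻¹ * l) • (ω : F) := by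
      rw [mul_smul, mul_smul, ← smul_add, Int.cast_smul_eq_zsmul, Int.cast_smul_eq_zsmul, ← hF,
        ← Int.cast_smul_eq_zsmul ℚ d, smul_smul, inv_mul_cancel₀ hd', one_smul]
    rw [hzeq]
    exact add_mem (Submodule.smul_mem _ _ (Submodule.subset_span ⟨0, rfl⟩))
      (Submodule.smul_mem _ _ (Submodule.subset_span ⟨1, rfl⟩))
  let B := basisOfTopLeSpanOfCardEqFinrank ![(1 : F), ω] hspan (by
    rw [Fintype.card_fin, Algebra.IsQuadraticExtension.finrank_eq_two])
  exact ⟨B, by simp [B], by simp [B]⟩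

/-! ### Proper isometries and the ideal model of `L` -/

/-- A proper isometry of a quadratic field fixing `1` is the identity. -/
theorem eq_self_of_norm_of_det_eq_one {F : Type*} [Field F] [Algebra ℚ F]
    (B : Module.Basis (Fin 2) ℚ F) (h0 : B 0 = 1) (ρ : F →ₗ[ℚ] F)
    (hN : ∀ z, Algebra.norm ℚ (ρ z) = Algebra.norm ℚ z) (hρ : ρ 1 = 1) (hdet : LinearMap.det ρ = 1)
    (z : F) : ρ z = z := by
  have hrep : ∀ x : F, x = B.repr x 0 • 1 + B.repr x 1 • B 1 := fun x => by
    conv_lhs => rw [← B.sum_repr x, Fin.sum_univ_two, h0]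
  obtain ⟨T, N, hTN⟩ : ∃ T N : ℚ, B 1 * B 1 = T • B 1 - N • 1 :=
    ⟨B.repr (B 1 * B 1) 1, -B.repr (B 1 * B 1) 0, by
      conv_lhs => rw [hrep (B 1 * B 1)]
      module⟩
  have hnorm := fun x y => (trace_of_basis_one B h0 hTN x y).2
  set x := B.repr (ρ (B 1)) 0 with hx
  set y := B.repr (ρ (B 1)) 1 with hy
  have hρ1 : ρ (B 1) = x • 1 + y • B 1 := hrep _
  have hy1 : y = 1 := by
    rw [← LinearMap.det_toMatrix B, Matrix.det_fin_two] at hdet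
    simp only [LinearMap.toMatrix_apply, h0, hρ] at hdet
    rw [← h0, B.repr_self] at hdet
    simpa [← hy] using hdet
  -- Subtracting the norm identities for `B 1` and `1 + B 1` cancels the quadratic terms and leaves
  -- `2x = 0`.
  have hx0 : x = 0 := by
    have e0 := hN ((0 : ℚ) • 1 + (1 : ℚ) • B 1)
    have e1 := hN ((1 : ℚ) • 1 + (1 : ℚ) • B 1)
    rw [hnorm] at e0 e1
    rw [show ρ ((0 : ℚ) • 1 + (1 : ℚ) • B 1) = x • 1 + (1 : ℚ) • B 1 by
      simp [hρ1, hy1], hnorm] at e0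
    rw [show ρ ((1 : ℚ) • 1 + (1 : ℚ) • B 1) = (1 + x) • 1 + (1 : ℚ) • B 1 by
      simp [hρ1, hρ, hy1, add_smul, add_assoc], hnorm] at e1
    linear_combination (e1 - e0) / 2
  rw [hrep z, map_add, map_smul, map_smul, hρ, hρ1, hx0, hy1]
  module

theorem norm_inv_eq_one {F : Type*} [Field F] [Algebra ℚ F] {u : F} (hu0 : u ≠ 0)
    (hu : Algebra.norm ℚ u = 1) :
    Algebra.norm ℚ u⁻¹ = 1 := by
  have := map_mul (Algebra.norm ℚ) u u⁻¹
  rwa [mul_inv_cancel₀ hu0, map_one, hu, one_mul, eq_comm] at this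

/-- Transport `σ` to `F` and divide by the image `u` of `1`: the result is a proper isometry fixing
`1`, hence the identity. Conversely, the determinant of multiplication by `u` is its norm. -/
theorem mem_specialOrthogonal_iff_mul {F : Type*} [Field F] [Algebra ℚ F]
    (B : Module.Basis (Fin 2) ℚ F) (hB : B 0 = 1)
    {V : Type*} [AddCommGroup V] [Module ℚ V] (Q : QuadraticForm ℚ V) (φ : V ≃ₗ[ℚ] F) {a : ℚ}
    (ha : a ≠ 0) (hφ : ∀ v, Algebra.norm ℚ (φ v) = a * Q v) (σ : V ≃ₗ[ℚ] V) :
    σ ∈ specialOrthogonal Q ↔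
      ∃ u : Fˣ, Algebra.norm ℚ (u : F) = 1 ∧ ∀ v, φ (σ v) = u * φ v := by
  have := B.finiteDimensional_of_finite
  constructor
  · rintro ⟨h1, h2⟩
    have hQ : ∀ v, Q (σ v) = Q v := fun v => by
      have := h1 v v
      rwa [QuadraticMap.associated_eq_self_apply, QuadraticMap.associated_eq_self_apply] at this
    let σ' : F →ₗ[ℚ] F := φ ∘ₗ (σ : V →ₗ[ℚ] V) ∘ₗ φ.symm
    have hσ' : ∀ z, Algebra.norm ℚ (σ' z) = Algebra.norm ℚ z := fun z => by
      change Algebra.norm ℚ (φ (σ (φ.symm z))) = _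
      rw [hφ, hQ, ← hφ, LinearEquiv.apply_symm_apply]
    have hdet : LinearMap.det σ' = 1 := by
      rw [← h2]
      exact LinearMap.det_conj _ φ
    have hu : Algebra.norm ℚ (σ' 1) = 1 := by rw [hσ', map_one]
    have hu0 : σ' 1 ≠ 0 := fun h => by
      rw [h, Algebra.norm_zero] at hu
      exact zero_ne_one hu
    refine ⟨Units.mk0 (σ' 1) hu0, hu, fun v => ?_⟩
    have hinv : Algebra.norm ℚ (σ' 1)⁻¹ = 1 := norm_inv_eq_one hu0 hu
    have key := eq_self_of_norm_of_det_eq_one B hB (Algebra.lmul ℚ F (σ' 1)⁻¹ ∘ₗ σ')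
      (fun z => by
        change Algebra.norm ℚ ((σ' 1)⁻¹ * σ' z) = _
        rw [map_mul, hinv, one_mul, hσ']) (inv_mul_cancel₀ hu0) (by
        rw [LinearMap.det_comp, hdet, mul_one, ← Algebra.norm_apply, hinv]) (φ v)
    change (σ' 1)⁻¹ * φ (σ (φ.symm (φ v))) = φ v at key
    rw [LinearEquiv.symm_apply_apply] at key
    rw [Units.val_mk0, ← key, mul_inv_cancel_left₀ hu0]
  · rintro ⟨u, hu, h⟩
    have hQ : ∀ v, Q (σ v) = Q v := fun v => by
      have := hφ (σ v)
      rw [h, map_mul, hu, one_mul, hφ] at this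
      exact (mul_left_cancel₀ ha this).symm
    refine ⟨fun x y => ?_, ?_⟩
    · rw [QuadraticMap.associated_apply, QuadraticMap.associated_apply, ← map_add, hQ, hQ, hQ]
    · rw [← LinearMap.det_conj (σ : V →ₗ[ℚ] V) φ, ← hu, Algebra.norm_apply]
      congr 1
      ext z
      change φ (σ (φ.symm z)) = u * z
      rw [h, LinearEquiv.apply_symm_apply]

open NumberField in
/-- The image of an ideal of `𝓞 F` in the additive group of `F`. -/
def idealSubgroup {F : Type*} [Field F] (I : Ideal (𝓞 F)) : AddSubgroup F :=
  (Submodule.toAddSubgroup I).map (algebraMap (𝓞 F) F : 𝓞 F →+ F)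

open NumberField in
theorem mem_idealSubgroup {F : Type*} [Field F] {I : Ideal (𝓞 F)} {z : F} :
    z ∈ idealSubgroup I ↔ ∃ x ∈ I, (x : F) = z := Iff.rfl

open NumberField in
theorem coe_mem_idealSubgroup {F : Type*} [Field F] {I : Ideal (𝓞 F)} {x : 𝓞 F} :
    (x : F) ∈ idealSubgroup I ↔ x ∈ I :=
  ⟨fun ⟨_, hy, h⟩ => RingOfIntegers.ext h ▸ hy, fun h => ⟨x, h, rfl⟩⟩

open NumberField in
/-- A definite binary form `Q` of fundamental discriminant is, up to a scalar, the norm form on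
an ideal of the corresponding quadratic field. -/
theorem exists_ideal_model {F : Type*} [Field F] [NumberField F]
    [Algebra.IsQuadraticExtension ℚ F] {V : Type*} [AddCommGroup V] [Module ℚ V]
    (Q : QuadraticForm ℚ V) (hQ : Q.PosDef) (e : Module.Basis (Fin 2) ℚ V)
    (hint : ∀ x ∈ Submodule.span ℤ (Set.range e), ∃ n : ℤ, Q x = (n : ℚ))
    (hdisc : -4 * (gramMatrix Q e).det = (discr F : ℚ)) :
    ∃ (φ : V ≃ₗ[ℚ] F) (I : Ideal (𝓞 F)), I ≠ ⊥ ∧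
      (Submodule.span ℤ (Set.range e)).toAddSubgroup.map (φ : V →+ F) = idealSubgroup I ∧
      (∀ z : F, z ≠ 0 → 0 < Algebra.norm ℚ z) ∧
      ∀ σ : V ≃ₗ[ℚ] V, σ ∈ specialOrthogonal Q ↔
        ∃ u : Fˣ, Algebra.norm ℚ (u : F) = 1 ∧ ∀ v, φ (σ v) = u * φ v := by
  have hmem : ∀ i, e i ∈ Submodule.span ℤ (Set.range e) := fun i =>
    Submodule.subset_span ⟨i, rfl⟩
  obtain ⟨a, ha⟩ := hint _ (hmem 0)
  obtain ⟨c, hc⟩ := hint _ (hmem 1)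
  obtain ⟨d, hd⟩ := hint _ (add_mem (hmem 0) (hmem 1))
  have ha0 : (0 : ℚ) < a := ha ▸ hQ _ (e.ne_zero 0)
  have hpolar : QuadraticMap.polar Q (e 0) (e 1) = ((d - a - c : ℤ) : ℚ) := by
    rw [QuadraticMap.polar, hd, ha, hc]
    push_cast
    ring
  set b := d - a - c with hb
  have hQe : ∀ x y : ℚ, Q (x • e 0 + y • e 1) = a * x ^ 2 + b * x * y + c * y ^ 2 := fun x y => by
    rw [QuadraticMap.map_add Q, QuadraticMap.map_smul, QuadraticMap.map_smul,
      QuadraticMap.polar_smul_left, QuadraticMap.polar_smul_right, hpolar, ha, hc]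
    simp only [smul_eq_mul]
    ring
  have hdisc' : b ^ 2 - 4 * (a * c) = discr F := by
    have h01 : QuadraticMap.associated Q (e 0) (e 1) = (b : ℚ) / 2 := by
      rw [← hpolar, QuadraticMap.associated_apply, QuadraticMap.polar]
      simp [div_eq_inv_mul]
    have h10 : QuadraticMap.associated Q (e 1) (e 0) = (b : ℚ) / 2 := by
      rw [← h01, QuadraticMap.associated_isSymm]
    rw [Matrix.det_fin_two] at hdisc
    simp only [gramMatrix, Matrix.of_apply, QuadraticMap.associated_eq_self_apply, h01, h10, ha,
      hc] at hdisc
    have : ((b ^ 2 - 4 * (a * c) : ℤ) : ℚ) = (discr F : ℚ) := by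
      rw [← hdisc]
      push_cast
      ring
    exact_mod_cast this
  obtain ⟨ω, hω, hgen⟩ := exists_generator_ringOfIntegers hdisc'
  obtain ⟨B, hB0, hB1⟩ := exists_basis_of_generator hgen
  have hωF : B 1 * B 1 = (b : ℚ) • B 1 - (a * c : ℚ) • (1 : F) := by
    have := congrArg (fun x : 𝓞 F => (x : F)) hω
    simp only [map_mul, map_sub, map_zsmul, map_one] at this
    rw [hB1, this, Int.cast_smul_eq_zsmul, ← Int.cast_mul, Int.cast_smul_eq_zsmul]
  have hunit : ∀ i, IsUnit ((![(a : ℚ), 1] : Fin 2 → ℚ) i) := by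
    intro i
    fin_cases i
    · exact isUnit_iff_ne_zero.2 ha0.ne'
    · exact isUnit_one
  -- With `e 0 ↦ a` and `e 1 ↦ ω`, the norm of `ax + ωy` is `a²x² + abxy + acy²`, which is `a` times
  -- the form.
  let φ : V ≃ₗ[ℚ] F := e.equiv (B.isUnitSMul hunit) (Equiv.refl _)
  have hφ0 : φ (e 0) = (a : ℚ) • 1 := by simp [φ, Module.Basis.isUnitSMul_apply, hB0]
  have hφ1 : φ (e 1) = B 1 := by simp [φ, Module.Basis.isUnitSMul_apply]
  have hφ : ∀ v, Algebra.norm ℚ (φ v) = a * Q v := by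
    intro v
    rw [← e.sum_repr v, Fin.sum_univ_two, hQe, map_add, map_smul, map_smul, hφ0, hφ1, smul_smul,
      (trace_of_basis_one B hB0 hωF _ _).2]
    ring
  let I : Ideal (𝓞 F) :=
    { carrier := {x | ∃ k l : ℤ, x = (k * a) • 1 + l • ω}
      zero_mem' := ⟨0, 0, by simp⟩
      add_mem' := by
        rintro _ _ ⟨k, l, rfl⟩ ⟨k', l', rfl⟩
        exact ⟨k + k', l + l', by module⟩
      smul_mem' := by
        rintro x _ ⟨k, l, rfl⟩
        obtain ⟨s, t, rfl⟩ := hgen x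
        -- Expand `(s + tω)(ka + lω)` using `ω² = bω - ac`; the term `-ac` is divisible by `a`,
        -- which is why `ℤa + ℤω` is an ideal.
        refine ⟨s * k - t * l * c, s * l + t * k * a + t * l * b, ?_⟩
        rw [smul_eq_mul, add_mul, mul_add, mul_add]
        simp only [smul_mul_assoc, mul_smul_comm, one_mul, mul_one, hω]
        module }
  have hcomb : ∀ k l : ℤ, φ (k • e 0 + l • e 1) = (((k * a) • 1 + l • ω : 𝓞 F) : F) := by
    intro k l
    rw [map_add, map_zsmul, map_zsmul, hφ0, hφ1, Int.cast_smul_eq_zsmul, smul_smul, hB1]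
    simp only [map_add, map_zsmul, map_one]
  have hspan : ∀ v, v ∈ Submodule.span ℤ (Set.range e) ↔ ∃ k l : ℤ, k • e 0 + l • e 1 = v := by
    intro v
    rw [← Submodule.mem_span_pair]
    congr! 2
    ext
    simp [eq_comm]
  have hmap : (Submodule.span ℤ (Set.range e)).toAddSubgroup.map (φ : V →+ F) =
      idealSubgroup I := by
    ext z
    rw [mem_idealSubgroup, AddSubgroup.mem_map]
    constructor
    · rintro ⟨v, hv, rfl⟩
      obtain ⟨k, l, rfl⟩ := (hspan v).1 hv
      exact ⟨_, ⟨k, l, rfl⟩, (hcomb k l).symm⟩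
    · rintro ⟨_, ⟨k, l, rfl⟩, rfl⟩
      exact ⟨_, (hspan _).2 ⟨k, l, rfl⟩, hcomb k l⟩
  refine ⟨φ, I, ?_, hmap, ?_, mem_specialOrthogonal_iff_mul B hB0 Q φ ha0.ne' hφ⟩
  · intro hI
    have h1 : ω ∈ I := ⟨0, 1, by simp⟩
    rw [hI, Submodule.mem_bot] at h1
    exact B.ne_zero 1 (by rw [hB1, h1]; exact map_zero _)
  · intro z hz
    obtain ⟨v, rfl⟩ := φ.surjective z
    rw [hφ]
    exact mul_pos ha0 (hQ v fun h => hz (by rw [h, map_zero]))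

open scoped Pointwise in
/-- Equivalence of subgroups of a field `F` under multiplication by elements of norm `1`. -/
def normOneSetoid {F : Type*} [Field F] [Algebra ℚ F] (A : AddSubgroup F) (m : ℕ) :
    Setoid (subgroupsOfRelIndex A m) where
  r K₁ K₂ := ∃ u : Fˣ, Algebra.norm ℚ (u : F) = 1 ∧ u • K₁.1 = K₂.1
  iseqv :=
    { refl := fun K => ⟨1, by simp, one_smul _ _⟩
      symm := by
        rintro K₁ K₂ ⟨u, hu, h⟩
        exact ⟨u⁻¹, by rw [Units.val_inv_eq_inv_val, norm_inv_eq_one u.ne_zero hu],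
          by rw [← h, inv_smul_smul]⟩
      trans := by
        rintro K₁ K₂ K₃ ⟨u, hu, h⟩ ⟨v, hv, h'⟩
        exact ⟨v * u, by rw [Units.val_mul, map_mul, hu, hv, one_mul], by rw [mul_smul, h, h']⟩ }

open scoped Pointwise in
theorem properClassCount_eq_card {F : Type*} [Field F] [Algebra ℚ F]
    {V : Type*} [AddCommGroup V] [Module ℚ V] (Q : QuadraticForm ℚ V) (φ : V ≃ₗ[ℚ] F)
    (L : Submodule ℤ V) (A : AddSubgroup F) (hA : L.toAddSubgroup.map (φ : V →+ F) = A)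
    (hφ : ∀ σ : V ≃ₗ[ℚ] V, σ ∈ specialOrthogonal Q ↔
      ∃ u : Fˣ, Algebra.norm ℚ (u : F) = 1 ∧ ∀ v, φ (σ v) = u * φ v) (m : ℕ) :
    properClassCount Q L m = Nat.card (Quotient (normOneSetoid A m)) := by
  subst hA
  have hinj : Function.Injective (φ : V →+ F) := φ.injective
  let g : sublatticesOfIndex L m → subgroupsOfRelIndex (L.toAddSubgroup.map (φ : V →+ F)) m :=
    fun K => ⟨K.1.toAddSubgroup.map (φ : V →+ F), AddSubgroup.map_mono K.2.1, by
      rw [AddSubgroup.relIndex_map_map_of_injective _ _ hinj, K.2.2]⟩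
  have hg : Function.Bijective g := by
    constructor
    · intro K₁ K₂ h
      exact Subtype.ext (Submodule.toAddSubgroup_injective
        (AddSubgroup.map_injective hinj (congrArg Subtype.val h)))
    · rintro ⟨K, hK, hK'⟩
      obtain ⟨H, rfl⟩ : ∃ H : AddSubgroup V, H.map (φ : V →+ F) = K :=
        ⟨K.comap (φ : V →+ F), AddSubgroup.map_comap_eq_self_of_surjective φ.surjective K⟩
      refine ⟨⟨AddSubgroup.toIntSubmodule H, ?_, ?_⟩, rfl⟩
      · exact (AddSubgroup.map_le_map_iff_of_injective hinj).1 hK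
      · rwa [AddSubgroup.relIndex_map_map_of_injective _ _ hinj] at hK'
  refine Nat.card_congr (Quotient.congr (Equiv.ofBijective g hg) ?_)
  intro K₁ K₂
  have himage : ∀ (σ : V ≃ₗ[ℚ] V) (u : Fˣ), (∀ v, φ (σ v) = u * φ v) →
      (latticeImage σ K₁.1 = K₂.1 ↔ u • (g K₁).1 = (g K₂).1) := by
    intro σ u h
    have : u • (g K₁).1 = (latticeImage σ K₁.1).toAddSubgroup.map (φ : V →+ F) := by
      ext z
      constructor
      · rintro ⟨_, ⟨v, hv, rfl⟩, rfl⟩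
        exact ⟨σ v, ⟨v, hv, rfl⟩, h v⟩
      · rintro ⟨_, ⟨v, hv, rfl⟩, rfl⟩
        exact ⟨φ v, ⟨v, hv, rfl⟩, (h v).symm⟩
    rw [this]
    exact ⟨fun h => by rw [h], fun h => Submodule.toAddSubgroup_injective
        (AddSubgroup.map_injective hinj h)⟩
  constructor
  · rintro ⟨σ, hσ, h⟩
    obtain ⟨u, hu, huσ⟩ := (hφ σ).1 hσ
    exact ⟨u, hu, (himage σ u huσ).1 h⟩
  · rintro ⟨u, hu, h⟩
    let σ : V ≃ₗ[ℚ] V := φ.trans ((DistribMulAction.toLinearEquiv ℚ F u).trans φ.symm)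
    have huσ : ∀ v, φ (σ v) = u * φ v := fun v => by
      simp [σ]
      rfl
    exact ⟨σ, (hφ σ).2 ⟨u, hu, huσ⟩, (himage σ u huσ).2 h⟩

/-! ### Norm-one multipliers and primes with a single prime above -/

open NumberField nonZeroDivisors
open scoped Pointwise

theorem idealSubgroup_mono {F : Type*} [Field F] {I J : Ideal (𝓞 F)} (h : I ≤ J) :
    idealSubgroup I ≤ idealSubgroup J :=
  AddSubgroup.map_mono h

theorem mul_mem_units_smul {F : Type*} [Field F] {u : Fˣ} {K : AddSubgroup F} {z : F} (hz : z ∈ K) :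
    u * z ∈ u • K :=
  ⟨z, hz, rfl⟩

theorem mem_units_smul_iff {F : Type*} [Field F] {u : Fˣ} {K : AddSubgroup F} {z : F} :
    z ∈ u • K ↔ ((u⁻¹ : Fˣ) : F) * z ∈ K := by
  constructor
  · rintro ⟨y, hy, rfl⟩
    have : ((u⁻¹ : Fˣ) : F) * (u * y) = y := Units.inv_mul_cancel_left u y
    exact this.symm ▸ hy
  · exact fun h => ⟨_, h, Units.mul_inv_cancel_left u z⟩

theorem smul_eq_self_of_eq_one_or_neg_one {F : Type*} [Field F] {u : Fˣ} (h : u = 1 ∨ u = -1)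
    (K : AddSubgroup F) : u • K = K := by
  rcases h with rfl | rfl
  · exact one_smul _ _
  · ext z
    rw [mem_units_smul_iff]
    simp

theorem eq_one_or_neg_one_of_unit {F : Type*} [Field F] (hunits : Nat.card (𝓞 F)ˣ = 2)
    {u : Fˣ} (v : (𝓞 F)ˣ) (h : ((v : 𝓞 F) : F) = u) : u = 1 ∨ u = -1 := by
  have hv : v ^ 2 = 1 := hunits ▸ pow_card_eq_one'
  have hu : (u : F) ^ 2 = 1 := by
    rw [← h]
    have := congrArg (fun v : (𝓞 F)ˣ => ((v : 𝓞 F) : F)) hv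
    simpa using this
  rcases mul_self_eq_one_iff.1 (by rw [← sq, hu] : (u : F) * u = 1) with h | h
  · exact Or.inl (Units.ext h)
  · exact Or.inr (Units.ext h)

section

variable {F : Type*} [Field F] [NumberField F]

theorem relIndex_idealSubgroup_mul {I : Ideal (𝓞 F)} (hI : I ≠ ⊥) (J : Ideal (𝓞 F)) :
    (idealSubgroup (J * I)).relIndex (idealSubgroup I) = Ideal.absNorm J := by
  have h : ∀ I : Ideal (𝓞 F), (Submodule.toAddSubgroup I).index = Ideal.absNorm I := fun _ => rfl
  have h0 : Ideal.absNorm I ≠ 0 := fun h => hI (Ideal.absNorm_eq_zero_iff.1 h)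
  rw [idealSubgroup, idealSubgroup, AddSubgroup.relIndex_map_map_of_injective _ _
    (FaithfulSMul.algebraMap_injective (𝓞 F) F)]
  refine mul_right_cancel₀ h0 ?_
  rw [← h I, AddSubgroup.relIndex_mul_index (show J * I ≤ I from Ideal.mul_le_right), h, h, map_mul]

theorem bijOn_idealSubgroup [Algebra.IsQuadraticExtension ℚ F] {I : Ideal (𝓞 F)} (hI : I ≠ ⊥)
    (m : ℕ) : ∃ f : ℤ × ℤ →+ F,
      Set.BijOn (AddSubgroup.map f) {K | K.index = m}
        (subgroupsOfRelIndex (idealSubgroup I) m) := by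
  obtain ⟨B, -⟩ := exists_basis_ringOfIntegers_one (F := F)
  let e : (ℤ × ℤ) ≃ₗ[ℤ] I :=
    (LinearEquiv.finTwoArrow ℤ ℤ).symm.trans (Ideal.selfBasis B I hI).equivFun.symm
  let f : ℤ × ℤ →+ F := (algebraMap (𝓞 F) F : 𝓞 F →+ F).comp
    ((Submodule.toAddSubgroup I).subtype.comp (e : (ℤ × ℤ) →+ I))
  refine ⟨f, bijOn_subgroupsOfRelIndex _ f ?_ ?_ m⟩
  · exact (FaithfulSMul.algebraMap_injective (𝓞 F) F).comp
      (Subtype.val_injective.comp e.injective)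
  · ext z
    constructor
    · rintro ⟨x, rfl⟩
      exact ⟨_, (e x).2, rfl⟩
    · rintro ⟨x, hx, rfl⟩
      obtain ⟨y, hy⟩ := e.surjective ⟨x, hx⟩
      exact ⟨y, congrArg (fun x : I => ((x : 𝓞 F) : F)) hy⟩

theorem finite_subgroupsOfRelIndex [Algebra.IsQuadraticExtension ℚ F] {I : Ideal (𝓞 F)}
    (hI : I ≠ ⊥) {m : ℕ} (hm : m ≠ 0) : (subgroupsOfRelIndex (idealSubgroup I) m).Finite :=
  (bijOn_idealSubgroup hI m).choose_spec.finite_iff_finite.1 (finite_setOf_index_eq hm)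

theorem ncard_subgroupsOfRelIndex_prime_pow [Algebra.IsQuadraticExtension ℚ F]
    {I : Ideal (𝓞 F)} (hI : I ≠ ⊥) {p : ℕ} (hp : p.Prime) (i : ℕ) :
    (subgroupsOfRelIndex (idealSubgroup I) (p ^ i)).ncard =
      ∑ k ∈ Finset.range (i + 1), p ^ k := by
  obtain ⟨f, hf⟩ := bijOn_idealSubgroup hI (p ^ i)
  rw [← hf.image_eq, hf.injOn.ncard_image, ncard_setOf_index_eq (pow_ne_zero _ hp.ne_zero),
    Nat.sum_divisors_prime_pow hp]

/-- An element of `F` which stabilises a nonzero ideal is an algebraic integer. -/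
theorem exists_eq_of_mul_mem_idealSubgroup {I : Ideal (𝓞 F)} (hI : I ≠ ⊥) (x : F)
    (hx : ∀ z ∈ idealSubgroup I, x * z ∈ idealSubgroup I) : ∃ y : 𝓞 F, (y : F) = x := by
  obtain ⟨y, hy, hy0⟩ := Submodule.exists_mem_ne_zero_of_ne_bot hI
  have hfg : (AddSubgroup.toIntSubmodule (idealSubgroup I)).FG :=
    (IsNoetherian.noetherian (I.restrictScalars ℤ)).map
      ((Algebra.linearMap (𝓞 F) F).restrictScalars ℤ)
  have hint : IsIntegral ℤ x := by
    refine isIntegral_of_smul_mem_submodule (AddSubgroup.toIntSubmodule (idealSubgroup I)) ?_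
      hfg x hx
    intro h
    have : (y : F) ∈ AddSubgroup.toIntSubmodule (idealSubgroup I) := coe_mem_idealSubgroup.2 hy
    rw [h, Submodule.mem_bot] at this
    exact hy0 (RingOfIntegers.ext this)
  exact ⟨⟨x, hint⟩, rfl⟩

theorem nsmul_mem_of_mem_subgroupsOfRelIndex {G : Type*} [AddCommGroup G] {A K : AddSubgroup G}
    {m : ℕ} (hK : K ∈ subgroupsOfRelIndex A m) {z : G} (hz : z ∈ A) : m • z ∈ K := by
  have := (K.addSubgroupOf A).nsmul_index_mem ⟨z, hz⟩
  rw [← hK.2]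
  exact this

/-- Since `mI ⊆ K₁`, also `(mu)I ⊆ uK₁ = K₂ ⊆ I`; a multiplier of a nonzero ideal is integral. -/
theorem exists_eq_mul_of_smul_eq {I : Ideal (𝓞 F)} (hI : I ≠ ⊥) {m : ℕ} {K₁ K₂ : AddSubgroup F}
    (h₁ : K₁ ∈ subgroupsOfRelIndex (idealSubgroup I) m)
    (h₂ : K₂ ∈ subgroupsOfRelIndex (idealSubgroup I) m) {u : Fˣ} (h : u • K₁ = K₂) :
    ∃ x : 𝓞 F, (x : F) = m * u := by
  refine exists_eq_of_mul_mem_idealSubgroup hI _ fun z hz => ?_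
  have := mul_mem_units_smul (u := u) (nsmul_mem_of_mem_subgroupsOfRelIndex h₁ hz)
  rw [h] at this
  convert h₂.1 this using 1
  rw [nsmul_eq_mul]
  ring

theorem absNorm_span_eq_pow [Algebra.IsQuadraticExtension ℚ F] {m : ℕ} {u : F}
    (hu : Algebra.norm ℚ u = 1) {x : 𝓞 F} (hx : (x : F) = m * u) :
    Ideal.absNorm (Ideal.span {x}) = m ^ 2 := by
  rw [Ideal.absNorm_span_singleton]
  have h1 : ((Algebra.norm ℤ x : ℤ) : ℚ) = ((m ^ 2 : ℕ) : ℚ) := by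
    have hm : (m : F) = algebraMap ℚ F m := by simp
    rw [Algebra.coe_norm_int, hx, map_mul, hu, hm, Algebra.norm_algebraMap,
      Algebra.IsQuadraticExtension.finrank_eq_two]
    simp
  have h2 : Algebra.norm ℤ x = ((m ^ 2 : ℕ) : ℤ) := by exact_mod_cast h1
  rw [h2, Int.natAbs_natCast]

/-- If a single prime lies above `p`, then an element of norm `1` which is integral up to powers
of `p`, as is its inverse, is a unit. -/
theorem eq_one_or_neg_one_of_span_eq_pow [Algebra.IsQuadraticExtension ℚ F]
    (hunits : Nat.card (𝓞 F)ˣ = 2) {p : ℕ} (hp : p.Prime) {𝔭 : Ideal (𝓞 F)} (h𝔭 : 𝔭.IsPrime)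
    {e : ℕ} (he : Ideal.span {(p : 𝓞 F)} = 𝔭 ^ e) {u : Fˣ} (hu : Algebra.norm ℚ (u : F) = 1)
    {i : ℕ} {x y : 𝓞 F} (hx : (x : F) = (p ^ i : ℕ) * u) (hy : (y : F) = (p ^ i : ℕ) * (u⁻¹ : Fˣ)) :
    u = 1 ∨ u = -1 := by
  have hp0 : (p : 𝓞 F) ≠ 0 := Nat.cast_ne_zero.2 hp.ne_zero
  have hpnorm : ∀ j : ℕ, Ideal.absNorm (Ideal.span {(p : 𝓞 F) ^ j}) = (p ^ j) ^ 2 := fun j =>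
    absNorm_span_eq_pow (u := 1) (map_one _) (by simp)
  have h𝔭0 : 𝔭 ≠ ⊥ := by
    rintro rfl
    rcases Nat.eq_zero_or_pos e with rfl | h
    · have := hpnorm 1
      rw [pow_one, he, pow_zero, map_one, pow_one] at this
      exact hp.one_lt.ne' (by nlinarith [hp.one_lt])
    · rw [← Ideal.zero_eq_bot, zero_pow h.ne', Ideal.zero_eq_bot, Ideal.span_singleton_eq_bot] at he
      exact hp0 he
  have hprime : Prime 𝔭 := Ideal.prime_of_isPrime h𝔭0 h𝔭
  have hxy : x * y = (p : 𝓞 F) ^ (2 * i) := by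
    apply RingOfIntegers.ext
    simp only [map_mul, hx, hy, map_pow, map_natCast, Nat.cast_pow]
    rw [mul_mul_mul_comm, ← Units.val_mul, mul_inv_cancel, Units.val_one, mul_one]
    ring
  -- Thus `(x)` is a power of `𝔭`; its norm `p^(2i)` pins down the exponent, so `(x) = (p^i)` and
  -- `u` is a unit.
  have hdvd : Ideal.span {x} ∣ 𝔭 ^ (e * (2 * i)) := by
    rw [pow_mul, ← he, Ideal.span_singleton_pow, ← hxy, ← Ideal.span_singleton_mul_span_singleton]
    exact dvd_mul_right _ _
  obtain ⟨j, -, hj⟩ := (dvd_prime_pow hprime _).1 hdvd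
  rw [associated_iff_eq] at hj
  have hnorm : Ideal.absNorm 𝔭 ^ j = Ideal.absNorm 𝔭 ^ (e * i) := by
    rw [← map_pow, ← map_pow, ← hj, pow_mul, ← he, Ideal.span_singleton_pow, hpnorm,
      absNorm_span_eq_pow hu hx]
  have h2 : 2 ≤ Ideal.absNorm 𝔭 := by
    have h0 : Ideal.absNorm 𝔭 ≠ 0 := fun h => h𝔭0 (Ideal.absNorm_eq_zero_iff.1 h)
    have h1 : Ideal.absNorm 𝔭 ≠ 1 := fun h => h𝔭.ne_top (Ideal.absNorm_eq_one_iff.1 h)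
    omega
  have hji := Nat.pow_right_injective h2 hnorm
  have hspan : Ideal.span {(p : 𝓞 F) ^ i} = Ideal.span {x} := by
    rw [hj, hji, pow_mul, ← he, Ideal.span_singleton_pow]
  obtain ⟨v, hv⟩ := Ideal.span_singleton_eq_span_singleton.1 hspan
  refine eq_one_or_neg_one_of_unit hunits v ?_
  have : (p : F) ^ i * ((v : 𝓞 F) : F) = p ^ i * u := by
    rw [← hv] at hx
    simpa using hx
  exact mul_left_cancel₀ (pow_ne_zero _ (Nat.cast_ne_zero.2 hp.ne_zero)) this

/-- Only `u = ±1` can relate two such subgroups, so equivalence is equality. The exponents `e = 1`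
and `e = 2` cover inert and ramified primes. -/
theorem card_normOneSetoid_of_span_eq_pow [Algebra.IsQuadraticExtension ℚ F]
    (hunits : Nat.card (𝓞 F)ˣ = 2) {I : Ideal (𝓞 F)} (hI : I ≠ ⊥) {p : ℕ} (hp : p.Prime)
    {𝔭 : Ideal (𝓞 F)} (h𝔭 : 𝔭.IsPrime) {e : ℕ} (he : Ideal.span {(p : 𝓞 F)} = 𝔭 ^ e) (i : ℕ) :
    Nat.card (Quotient (normOneSetoid (idealSubgroup I) (p ^ i))) =
      ∑ k ∈ Finset.range (i + 1), p ^ k := by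
  rw [card_quotient_of_trivial, ← ncard_subgroupsOfRelIndex_prime_pow hI hp i]
  · rfl
  · rintro K₁ K₂ ⟨u, hu, h⟩
    obtain ⟨x, hx⟩ := exists_eq_mul_of_smul_eq hI K₁.2 K₂.2 h
    obtain ⟨y, hy⟩ := exists_eq_mul_of_smul_eq hI K₂.2 K₁.2 (u := u⁻¹) (by rw [← h, inv_smul_smul])
    have := eq_one_or_neg_one_of_span_eq_pow hunits hp h𝔭 he hu hx hy
    exact Subtype.ext (by rw [← h, smul_eq_self_of_eq_one_or_neg_one this])

end

theorem relIndex_units_smul {F : Type*} [Field F] (u : Fˣ) (H K : AddSubgroup F) :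
    (u • H).relIndex (u • K) = H.relIndex K :=
  AddSubgroup.relIndex_map_map_of_injective H K
    (f := DistribSMul.toAddMonoidHom F (u : F)) (mul_right_injective₀ u.ne_zero)

/-! ### Split primes and the fractional ideal `𝔭/𝔮` -/

section

variable {F : Type*} [Field F] [NumberField F]

/-- The fractional ideal `𝔭 / 𝔮`. -/
noncomputable def idealQuotient (𝔭 𝔮 : (Ideal (𝓞 F))⁰) : (FractionalIdeal (𝓞 F)⁰ F)ˣ :=
  FractionalIdeal.mk0 F 𝔭 / FractionalIdeal.mk0 F 𝔮

theorem idealQuotient_inv (𝔭 𝔮 : (Ideal (𝓞 F))⁰) :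
    (idealQuotient 𝔭 𝔮)⁻¹ = idealQuotient 𝔮 𝔭 := inv_div _ _

theorem eq_one_or_neg_one_of_toPrincipalIdeal_eq_one (hunits : Nat.card (𝓞 F)ˣ = 2) {u : Fˣ}
    (h : toPrincipalIdeal (𝓞 F) F u = 1) : u = 1 ∨ u = -1 := by
  have hint : ∀ u : Fˣ, toPrincipalIdeal (𝓞 F) F u = 1 → ∃ x : 𝓞 F, (x : F) = u := by
    intro u h
    rw [toPrincipalIdeal_eq_iff, Units.val_one] at h
    have : (u : F) ∈ (1 : FractionalIdeal (𝓞 F)⁰ F) :=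
      h ▸ FractionalIdeal.mem_spanSingleton_self _ _
    exact (FractionalIdeal.mem_one_iff _).1 this
  obtain ⟨x, hx⟩ := hint u h
  obtain ⟨y, hy⟩ := hint u⁻¹ (by rw [map_inv, h, inv_one])
  have hxy : x * y = 1 := RingOfIntegers.ext (by
    simp only [map_mul, hx, hy, map_one, ← Units.val_mul, mul_inv_cancel, Units.val_one])
  exact eq_one_or_neg_one_of_unit hunits ⟨x, y, hxy, by rw [mul_comm, hxy]⟩ hx

theorem toPrincipalIdeal_idealQuotient_mul {𝔭 𝔮 : (Ideal (𝓞 F))⁰} {u : Fˣ} {m : ℕ}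
    (h : toPrincipalIdeal (𝓞 F) F u = idealQuotient 𝔭 𝔮 ^ m) :
    FractionalIdeal.spanSingleton (𝓞 F)⁰ (u : F) *
      ((𝔮.1 ^ m : Ideal (𝓞 F)) : FractionalIdeal (𝓞 F)⁰ F) =
      ((𝔭.1 ^ m : Ideal (𝓞 F)) : FractionalIdeal (𝓞 F)⁰ F) := by
  have h' : toPrincipalIdeal (𝓞 F) F u * FractionalIdeal.mk0 F 𝔮 ^ m =
      FractionalIdeal.mk0 F 𝔭 ^ m := by
    rw [h, idealQuotient, div_pow, div_mul_cancel]
  have := congrArg Units.val h'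
  simpa only [Units.val_mul, Units.val_pow_eq_pow_val, coe_toPrincipalIdeal,
    FractionalIdeal.coe_mk0, FractionalIdeal.coeIdeal_pow] using this

/-- This is `I ∩ u⁻¹I = 𝔮^m I`, from `u𝔮^m = 𝔭^m`. For the harder inclusion write `1 = a + b` with
`a ∈ 𝔭^m`, `b ∈ 𝔮^m`, and `a = ub'` with `b' ∈ 𝔮^m`; then `x = b'(ux) + bx`. -/
theorem mem_idealSubgroup_pow_mul_iff {𝔭 𝔮 : (Ideal (𝓞 F))⁰} (hcop : IsCoprime 𝔭.1 𝔮.1)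
    {u : Fˣ} {m : ℕ} (h : toPrincipalIdeal (𝓞 F) F u = idealQuotient 𝔭 𝔮 ^ m) (I : Ideal (𝓞 F))
    (z : F) : z ∈ idealSubgroup (𝔮.1 ^ m * I) ↔
      z ∈ idealSubgroup I ∧ u * z ∈ idealSubgroup I := by
  have key := toPrincipalIdeal_idealQuotient_mul h
  have h1 : ∀ b ∈ 𝔮.1 ^ m, ∃ a ∈ 𝔭.1 ^ m, (a : F) = u * b := by
    intro b hb
    have : u * (b : F) ∈ ((𝔭.1 ^ m : Ideal (𝓞 F)) : FractionalIdeal (𝓞 F)⁰ F) := by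
      rw [← key]
      exact FractionalIdeal.mul_mem_mul (FractionalIdeal.mem_spanSingleton_self _ _)
        (FractionalIdeal.mem_coeIdeal_of_mem _ hb)
    exact (FractionalIdeal.mem_coeIdeal _).1 this
  have h2 : ∀ a ∈ 𝔭.1 ^ m, ∃ b ∈ 𝔮.1 ^ m, (a : F) = u * b := by
    intro a ha
    have : (a : F) ∈ ((𝔭.1 ^ m : Ideal (𝓞 F)) : FractionalIdeal (𝓞 F)⁰ F) :=
      FractionalIdeal.mem_coeIdeal_of_mem _ ha
    rw [← key, FractionalIdeal.mem_singleton_mul] at this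
    obtain ⟨y, hy, hya⟩ := this
    obtain ⟨b, hb, rfl⟩ := (FractionalIdeal.mem_coeIdeal _).1 hy
    exact ⟨b, hb, hya⟩
  constructor
  · rintro ⟨x, hx, rfl⟩
    refine ⟨coe_mem_idealSubgroup.2 (Ideal.mul_le_right hx), ?_⟩
    change x ∈ 𝔮.1 ^ m * I at hx
    change u * (x : F) ∈ idealSubgroup I
    refine Submodule.mul_induction_on hx ?_ ?_
    · intro b hb y hy
      obtain ⟨a, -, ha⟩ := h1 b hb
      have : u * ((b * y : 𝓞 F) : F) = ((a * y : 𝓞 F) : F) := by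
        simp only [map_mul, ha, mul_assoc]
      rw [this]
      exact coe_mem_idealSubgroup.2 (I.mul_mem_left a hy)
    · intro x y hx hy
      have : u * ((x + y : 𝓞 F) : F) = u * (x : F) + u * (y : F) := by
        simp only [map_add, mul_add]
      rw [this]
      exact add_mem hx hy
  · rintro ⟨⟨x, hx, rfl⟩, ⟨y, hy, hxy⟩⟩
    change x ∈ I at hx
    change y ∈ I at hy
    change (y : F) = u * (x : F) at hxy
    change (x : F) ∈ _
    rw [coe_mem_idealSubgroup]
    obtain ⟨a, ha, b, hb, hab⟩ := Ideal.isCoprime_iff_exists.1 (hcop.pow (m := m) (n := m))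
    obtain ⟨b', hb', hab'⟩ := h2 a ha
    have hax : a * x = b' * y := RingOfIntegers.ext (by
      simp only [map_mul, hab', hxy]
      ring)
    rw [← one_mul x, ← hab, add_mul, hax]
    exact add_mem (Ideal.mul_mem_mul hb' hy) (Ideal.mul_mem_mul hb hx)

theorem smul_idealSubgroup_pow_mul {𝔭 𝔮 : (Ideal (𝓞 F))⁰} (hcop : IsCoprime 𝔭.1 𝔮.1)
    {u : Fˣ} {m : ℕ} (h : toPrincipalIdeal (𝓞 F) F u = idealQuotient 𝔭 𝔮 ^ m)
    (I : Ideal (𝓞 F)) : u • idealSubgroup (𝔮.1 ^ m * I) = idealSubgroup (𝔭.1 ^ m * I) := by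
  have h' : toPrincipalIdeal (𝓞 F) F u⁻¹ = idealQuotient 𝔮 𝔭 ^ m := by
    rw [map_inv, h, ← inv_pow, idealQuotient_inv]
  ext z
  rw [mem_units_smul_iff, mem_idealSubgroup_pow_mul_iff hcop h,
    mem_idealSubgroup_pow_mul_iff hcop.symm h', Units.mul_inv_cancel_left, and_comm]

/-- Containment of `uK` in `I` means `K ⊆ I ∩ u⁻¹I = 𝔮^m I`. The index is then automatic: `u`
carries `𝔮^m I` to `𝔭^m I`, and both have the same index in `I`. -/
theorem smul_mem_subgroupsOfRelIndex_iff {𝔭 𝔮 : (Ideal (𝓞 F))⁰} (hcop : IsCoprime 𝔭.1 𝔮.1)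
    (hnorm : Ideal.absNorm 𝔭.1 = Ideal.absNorm 𝔮.1) {u : Fˣ} {m : ℕ}
    (h : toPrincipalIdeal (𝓞 F) F u = idealQuotient 𝔭 𝔮 ^ m) {I : Ideal (𝓞 F)} (hI : I ≠ ⊥)
    {n : ℕ} {K : AddSubgroup F} (hK : K ∈ subgroupsOfRelIndex (idealSubgroup I) n) :
    u • K ∈ subgroupsOfRelIndex (idealSubgroup I) n ↔ K ≤ idealSubgroup (𝔮.1 ^ m * I) := by
  constructor
  · intro hu z hz
    exact (mem_idealSubgroup_pow_mul_iff hcop h I z).2 ⟨hK.1 hz, hu.1 (mul_mem_units_smul hz)⟩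
  · intro hle
    have hle' : u • K ≤ idealSubgroup (𝔭.1 ^ m * I) := by
      rw [← smul_idealSubgroup_pow_mul hcop h]
      exact AddSubgroup.map_mono hle
    refine ⟨hle'.trans (idealSubgroup_mono Ideal.mul_le_right), ?_⟩
    rw [← hK.2, ← AddSubgroup.relIndex_mul_relIndex _ _ _ hle'
      (idealSubgroup_mono Ideal.mul_le_right), ← AddSubgroup.relIndex_mul_relIndex _ _ _ hle
      (idealSubgroup_mono Ideal.mul_le_right), relIndex_idealSubgroup_mul hI,
      relIndex_idealSubgroup_mul hI, map_pow, map_pow, hnorm,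
      ← smul_idealSubgroup_pow_mul hcop h, relIndex_units_smul]

theorem subgroupsOfRelIndex_inter_setOf_le {p : ℕ} (hp : p.Prime) {I J : Ideal (𝓞 F)} (hI : I ≠ ⊥)
    {k : ℕ} (hJ : Ideal.absNorm J = p ^ k) (i : ℕ) :
    {K ∈ subgroupsOfRelIndex (idealSubgroup I) (p ^ i) | K ≤ idealSubgroup (J * I)} =
      if k ≤ i then subgroupsOfRelIndex (idealSubgroup (J * I)) (p ^ (i - k)) else ∅ := by
  have hle : idealSubgroup (J * I) ≤ idealSubgroup I := idealSubgroup_mono Ideal.mul_le_right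
  have hmul : ∀ K ≤ idealSubgroup (J * I),
      K.relIndex (idealSubgroup (J * I)) * p ^ k = K.relIndex (idealSubgroup I) := fun K hK => by
    rw [← hJ, ← relIndex_idealSubgroup_mul hI, AddSubgroup.relIndex_mul_relIndex _ _ _ hK hle]
  ext K
  split_ifs with hki
  · constructor
    · rintro ⟨⟨_, h⟩, hK⟩
      refine ⟨hK, ?_⟩
      rw [← hmul K hK, ← Nat.sub_add_cancel hki, pow_add] at h
      exact mul_right_cancel₀ (pow_ne_zero _ hp.ne_zero) (by simpa using h)
    · rintro ⟨hK, h⟩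
      refine ⟨⟨hK.trans hle, ?_⟩, hK⟩
      rw [← hmul K hK, h, ← pow_add, Nat.sub_add_cancel hki]
  · refine iff_of_false ?_ (Set.notMem_empty _)
    rintro ⟨⟨_, h⟩, hK⟩
    rw [← hmul K hK] at h
    exact hki ((Nat.pow_dvd_pow_iff_le_right hp.one_lt).1 ⟨_, by rw [mul_comm, h]⟩)
-- As `𝔭𝔮` is principal, `[𝔮] = [𝔭]⁻¹`; this is where the square in the definition of `k_p` comes
-- from.
theorem mk_idealQuotient {p : ℕ} {𝔭 𝔮 : (Ideal (𝓞 F))⁰}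
    (h : Ideal.span {(p : 𝓞 F)} = 𝔭.1 * 𝔮.1) :
    ClassGroup.mk F (idealQuotient 𝔭 𝔮) = ClassGroup.mk0 𝔭 ^ 2 := by
  have h1 : ClassGroup.mk0 𝔭 * ClassGroup.mk0 𝔮 = 1 := by
    rw [← map_mul]
    exact (ClassGroup.mk0_eq_one_iff (𝔭 * 𝔮).2).2 ⟨⟨p, h.symm⟩⟩
  rw [idealQuotient, map_div, ClassGroup.mk_mk0, ClassGroup.mk_mk0, eq_inv_of_mul_eq_one_right h1,
    div_inv_eq_mul, sq]

end

section

variable {F : Type*} [Field F] [NumberField F] [Algebra.IsQuadraticExtension ℚ F]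
  {p : ℕ} {𝔭 𝔮 : (Ideal (𝓞 F))⁰}

theorem absNorm_eq_of_split (hp : p.Prime) (h𝔭 : 𝔭.1.IsPrime) (h𝔮 : 𝔮.1.IsPrime)
    (h : Ideal.span {(p : 𝓞 F)} = 𝔭.1 * 𝔮.1) :
    Ideal.absNorm 𝔭.1 = p ∧ Ideal.absNorm 𝔮.1 = p := by
  have h1 : Ideal.absNorm (Ideal.span {(p : 𝓞 F)}) = p ^ 2 :=
    absNorm_span_eq_pow (u := 1) (map_one _) (by simp)
  rw [h, map_mul] at h1
  exact (hp.mul_eq_prime_sq_iff (fun h => h𝔭.ne_top (Ideal.absNorm_eq_one_iff.1 h))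
    (fun h => h𝔮.ne_top (Ideal.absNorm_eq_one_iff.1 h))).1 h1

/-- The ideal `(p^i u)` divides `(𝔭𝔮)^(2i)`, so it is `𝔭^a 𝔮^b`, and its norm gives `a + b = 2i`.
Dividing by `(𝔭𝔮)^i` leaves `(𝔭/𝔮)^(a-i)`. -/
theorem exists_toPrincipalIdeal_eq_zpow (hp : p.Prime) (h𝔭 : 𝔭.1.IsPrime) (h𝔮 : 𝔮.1.IsPrime)
    (h : Ideal.span {(p : 𝓞 F)} = 𝔭.1 * 𝔮.1) {u : Fˣ} (hu : Algebra.norm ℚ (u : F) = 1)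
    {i : ℕ} {x y : 𝓞 F} (hx : (x : F) = (p ^ i : ℕ) * u) (hy : (y : F) = (p ^ i : ℕ) * (u⁻¹ : Fˣ)) :
    ∃ n : ℤ, toPrincipalIdeal (𝓞 F) F u = idealQuotient 𝔭 𝔮 ^ n := by
  have hp0 : (p : F) ≠ 0 := Nat.cast_ne_zero.2 hp.ne_zero
  obtain ⟨hN𝔭, hN𝔮⟩ := absNorm_eq_of_split hp h𝔭 h𝔮 h
  have hxy : x * y = (p : 𝓞 F) ^ (2 * i) := by
    apply RingOfIntegers.ext
    simp only [map_mul, hx, hy, map_pow, map_natCast, Nat.cast_pow]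
    rw [mul_mul_mul_comm, ← Units.val_mul, mul_inv_cancel, Units.val_one, mul_one]
    ring
  have hdvd : Ideal.span {x} ∣ 𝔭.1 ^ (2 * i) * 𝔮.1 ^ (2 * i) := by
    rw [← mul_pow, ← h, Ideal.span_singleton_pow, ← hxy, ← Ideal.span_singleton_mul_span_singleton]
    exact dvd_mul_right _ _
  obtain ⟨J₁, J₂, h1, h2, hJ⟩ := exists_dvd_and_dvd_of_dvd_mul hdvd
  obtain ⟨a, -, ha⟩ := (dvd_prime_pow
    (Ideal.prime_of_isPrime (nonZeroDivisors.coe_ne_zero 𝔭) h𝔭) _).1 h1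
  obtain ⟨b, -, hb⟩ := (dvd_prime_pow
    (Ideal.prime_of_isPrime (nonZeroDivisors.coe_ne_zero 𝔮) h𝔮) _).1 h2
  rw [associated_iff_eq] at ha hb
  subst ha hb
  have hab : a + b = 2 * i := by
    have := absNorm_span_eq_pow hu hx
    rw [hJ, map_mul, map_pow, map_pow, hN𝔭, hN𝔮, ← pow_add, ← pow_mul, mul_comm i] at this
    exact Nat.pow_right_injective hp.two_le this
  set P := FractionalIdeal.mk0 F 𝔭
  set R := FractionalIdeal.mk0 F 𝔮
  have hmk : ∀ (z : Fˣ) (y : 𝓞 F) (j k : ℕ), (y : F) = z →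
      Ideal.span {y} = 𝔭.1 ^ j * 𝔮.1 ^ k → toPrincipalIdeal (𝓞 F) F z = P ^ j * R ^ k := by
    intro z y j k hy hjk
    rw [toPrincipalIdeal_eq_iff, ← hy, ← FractionalIdeal.coeIdeal_span_singleton, hjk]
    simp only [P, R, FractionalIdeal.coeIdeal_mul, FractionalIdeal.coeIdeal_pow, Units.val_mul,
      Units.val_pow_eq_pow_val, FractionalIdeal.coe_mk0]
  have e1 := hmk (Units.mk0 (p : F) hp0 ^ i * u) x a b (by simp [hx]) hJ
  have e2 := hmk (Units.mk0 (p : F) hp0) p 1 1 (by simp) (by rw [h, pow_one, pow_one])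
  rw [map_mul, map_pow, e2, pow_one, pow_one] at e1
  refine ⟨a - i, ?_⟩
  have hb : (b : ℤ) = i - (a - i) := by omega
  refine mul_left_cancel (e1.trans ?_)
  rw [idealQuotient, div_eq_mul_inv, mul_zpow, inv_zpow', mul_pow, mul_mul_mul_comm]
  simp only [← zpow_natCast]
  rw [← zpow_add, ← zpow_add, hb]
  congr 2
  ring

end

section

variable {F : Type*} [Field F] [NumberField F]

theorem exists_toPrincipalIdeal_eq_of_mk_eq_one {J : (FractionalIdeal (𝓞 F)⁰ F)ˣ}
    (h : ClassGroup.mk F J = 1) : ∃ u : Fˣ, toPrincipalIdeal (𝓞 F) F u = J := by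
  obtain ⟨x, hx⟩ := (FractionalIdeal.isPrincipal_iff _).1 (ClassGroup.mk_eq_one_iff.1 h)
  exact MonoidHom.mem_range.1 (mem_principal_ideals_iff.2 ⟨x, hx.symm⟩)

theorem mk_toPrincipalIdeal (u : Fˣ) : ClassGroup.mk F (toPrincipalIdeal (𝓞 F) F u) = 1 := by
  rw [ClassGroup.mk_eq_one_iff, coe_toPrincipalIdeal]
  exact (FractionalIdeal.isPrincipal_iff _).2 ⟨u, rfl⟩

theorem abs_norm_eq_one_of_toPrincipalIdeal {𝔭 𝔮 : (Ideal (𝓞 F))⁰}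
    (hnorm : Ideal.absNorm 𝔭.1 = Ideal.absNorm 𝔮.1) {u : Fˣ} {m : ℕ}
    (h : toPrincipalIdeal (𝓞 F) F u = idealQuotient 𝔭 𝔮 ^ m) : |Algebra.norm ℚ (u : F)| = 1 := by
  have := congrArg FractionalIdeal.absNorm (toPrincipalIdeal_idealQuotient_mul h)
  rw [map_mul, FractionalIdeal.absNorm_span_singleton, FractionalIdeal.coeIdeal_absNorm,
    FractionalIdeal.coeIdeal_absNorm, map_pow, map_pow, hnorm] at this
  have h0 : Ideal.absNorm 𝔮.1 ≠ 0 := fun h =>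
    nonZeroDivisors.coe_ne_zero 𝔮 (Ideal.absNorm_eq_zero_iff.1 h)
  exact mul_right_cancel₀ (Nat.cast_ne_zero.2 (pow_ne_zero m h0)) (this.trans (one_mul _).symm)

theorem isCoprime_of_isPrime_of_ne {𝔭 𝔮 : (Ideal (𝓞 F))⁰} (h𝔭 : 𝔭.1.IsPrime) (h𝔮 : 𝔮.1.IsPrime)
    (hne : 𝔭.1 ≠ 𝔮.1) : IsCoprime 𝔭.1 𝔮.1 :=
  have := h𝔭.isMaximal (nonZeroDivisors.coe_ne_zero 𝔭)
  have := h𝔮.isMaximal (nonZeroDivisors.coe_ne_zero 𝔮)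
  Ideal.isCoprime_of_isMaximal hne

end

section

variable {F : Type*} [Field F] [NumberField F] [Algebra.IsQuadraticExtension ℚ F]

/-- Orbit counting for a generator `τ` of `(𝔭/𝔮)^k`. The subtracted set is the family of subgroups
inside `𝔮^k I`; the identity is stated as a sum to avoid truncated subtraction. -/
theorem card_normOneSetoid_of_split (hunits : Nat.card (𝓞 F)ˣ = 2)
    (hpos : ∀ z : F, z ≠ 0 → 0 < Algebra.norm ℚ z) {I : Ideal (𝓞 F)} (hI : I ≠ ⊥)
    {p : ℕ} (hp : p.Prime) {𝔭 𝔮 : (Ideal (𝓞 F))⁰} (h𝔭 : 𝔭.1.IsPrime) (h𝔮 : 𝔮.1.IsPrime)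
    (hne : 𝔭.1 ≠ 𝔮.1) (hspan : Ideal.span {(p : 𝓞 F)} = 𝔭.1 * 𝔮.1) (i : ℕ) :
    Nat.card (Quotient (normOneSetoid (idealSubgroup I) (p ^ i))) +
      (if orderOf (ClassGroup.mk0 𝔭 ^ 2) ≤ i then
        ∑ j ∈ Finset.range (i - orderOf (ClassGroup.mk0 𝔭 ^ 2) + 1), p ^ j else 0) =
      ∑ j ∈ Finset.range (i + 1), p ^ j := by
  have hcop := isCoprime_of_isPrime_of_ne h𝔭 h𝔮 hne
  obtain ⟨hN𝔭, hN𝔮⟩ := absNorm_eq_of_split hp h𝔭 h𝔮 hspan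
  have hnorm : Ideal.absNorm 𝔭.1 = Ideal.absNorm 𝔮.1 := hN𝔭.trans hN𝔮.symm
  set k := orderOf (ClassGroup.mk0 𝔭 ^ 2) with hk
  have hkpos : 0 < k := orderOf_pos _
  have hclass := mk_idealQuotient (F := F) hspan
  obtain ⟨τ, hτ⟩ := exists_toPrincipalIdeal_eq_of_mk_eq_one (J := idealQuotient 𝔭 𝔮 ^ k)
    (by rw [map_pow, hclass, pow_orderOf_eq_one])
  have hτnorm : Algebra.norm ℚ (τ : F) = 1 := by
    rw [← abs_of_pos (hpos _ τ.ne_zero)]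
    exact abs_norm_eq_one_of_toPrincipalIdeal hnorm hτ
  have hτpow : ∀ n : ℕ, toPrincipalIdeal (𝓞 F) F (τ ^ n) = idealQuotient 𝔭 𝔮 ^ (k * n) :=
    fun n => by rw [map_pow, hτ, pow_mul]
  set S := subgroupsOfRelIndex (idealSubgroup I) (p ^ i) with hS
  let t : Equiv.Perm (AddSubgroup F) := MulAction.toPerm τ
  have htz : ∀ (n : ℤ) (K : AddSubgroup F), (t ^ n) K = τ ^ n • K := fun n K => by
    change ((MulAction.toPermHom Fˣ (AddSubgroup F) τ) ^ n) K = _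
    rw [← map_zpow]
    rfl
  have htn : ∀ (n : ℕ) (K : AddSubgroup F), (t ^ n) K = τ ^ n • K := fun n K => by
    simpa using htz n K
  have hmem : ∀ K ∈ S, ∀ n : ℕ, τ ^ n • K ∈ S ↔ K ≤ idealSubgroup (𝔮.1 ^ (k * n) * I) :=
    fun K hK n => smul_mem_subgroupsOfRelIndex_iff hcop hnorm (hτpow n) hI hK
  have hmem1 : ∀ K ∈ S, t K ∈ S ↔ K ≤ idealSubgroup (𝔮.1 ^ k * I) := fun K hK => by
    have := hmem K hK 1
    rwa [pow_one, mul_one] at this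
  have hcount := card_quotient_add_ncard_eq t S
    (finite_subgroupsOfRelIndex hI (pow_ne_zero i hp.ne_zero))
    (normOneSetoid (idealSubgroup I) (p ^ i)) ?_ ?_ ?_
  · rw [← ncard_subgroupsOfRelIndex_prime_pow hI hp i, ← hcount]
    congr 1
    have hset : {K ∈ S | t K ∈ S} = {K ∈ S | K ≤ idealSubgroup (𝔮.1 ^ k * I)} := by
      ext K
      exact and_congr_right fun hK => hmem1 K hK
    rw [hset, hS, subgroupsOfRelIndex_inter_setOf_le hp hI (by rw [map_pow, hN𝔮])]
    split_ifs
    · refine (ncard_subgroupsOfRelIndex_prime_pow ?_ hp _).symm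
      exact mul_ne_zero (pow_ne_zero _ (nonZeroDivisors.coe_ne_zero 𝔮)) hI
    · rw [Set.ncard_empty]
  · rintro ⟨K₁, h₁⟩ ⟨K₂, h₂⟩
    constructor
    · rintro ⟨u, hu, h⟩
      change u • K₁ = K₂ at h
      obtain ⟨x, hx⟩ := exists_eq_mul_of_smul_eq hI h₁ h₂ h
      obtain ⟨y, hy⟩ := exists_eq_mul_of_smul_eq hI h₂ h₁ (u := u⁻¹) (by rw [← h, inv_smul_smul])
      obtain ⟨n, hn⟩ := exists_toPrincipalIdeal_eq_zpow hp h𝔭 h𝔮 hspan hu hx hy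
      have hdvd : (k : ℤ) ∣ n := by
        rw [hk, orderOf_dvd_iff_zpow_eq_one, ← hclass, ← map_zpow, ← hn, mk_toPrincipalIdeal]
      obtain ⟨j, rfl⟩ := hdvd
      -- So `u` and `τ^j` differ by a unit `±1`, which acts trivially on subgroups.
      have hone : toPrincipalIdeal (𝓞 F) F (τ ^ (-j) * u) = 1 := by
        rw [map_mul, map_zpow, hτ, hn, zpow_mul, zpow_natCast, ← zpow_add, neg_add_cancel,
          zpow_zero]
      refine ⟨j, ?_⟩
      have := smul_eq_self_of_eq_one_or_neg_one
        (eq_one_or_neg_one_of_toPrincipalIdeal_eq_one hunits hone) K₁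
      change (t ^ j) K₁ = K₂
      rw [htz, ← h]
      conv_lhs => rw [← this]
      rw [smul_smul, zpow_neg, mul_inv_cancel_left]
    · rintro ⟨n, hn⟩
      rw [htz] at hn
      refine ⟨τ ^ n, ?_, hn⟩
      have h1 : Units.map (Algebra.norm ℚ) τ = 1 := Units.ext hτnorm
      have h2 : Units.map (Algebra.norm ℚ) (τ ^ n) = 1 := by rw [map_zpow, h1, one_zpow]
      exact congrArg Units.val h2
  · intro K hK n hn h
    rw [htn, hmem K hK] at h
    rw [hmem1 K hK]
    exact h.trans (idealSubgroup_mono (Ideal.mul_mono_left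
      (Ideal.pow_le_pow_right (Nat.le_mul_of_pos_right k hn))))
  · intro K hK
    -- Staying in `S` after `i + 1` steps would put `K` inside `𝔮^(k(i+1)) I`, of index `p^(k(i+1))
    -- > p^i` in `I`.
    refine ⟨i + 1, fun h => ?_⟩
    rw [htn, hmem K hK] at h
    have hdvd := AddSubgroup.relIndex_mul_relIndex _ _ _ h
      (idealSubgroup_mono (show 𝔮.1 ^ (k * (i + 1)) * I ≤ I from Ideal.mul_le_right))
    rw [relIndex_idealSubgroup_mul hI, hK.2, map_pow, hN𝔮] at hdvd
    have hle := (Nat.pow_dvd_pow_iff_le_right hp.one_lt).1 ⟨_, by rw [mul_comm, hdvd]⟩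
    have := Nat.le_mul_of_pos_left (i + 1) hkpos
    omega

theorem card_normOneSetoid_le {I : Ideal (𝓞 F)} (hI : I ≠ ⊥) {p : ℕ} (hp : p.Prime) (i : ℕ) :
    Nat.card (Quotient (normOneSetoid (idealSubgroup I) (p ^ i))) ≤
      ∑ j ∈ Finset.range (i + 1), p ^ j := by
  have := (finite_subgroupsOfRelIndex hI (pow_ne_zero i hp.ne_zero)).to_subtype
  rw [← ncard_subgroupsOfRelIndex_prime_pow hI hp i]
  exact Nat.card_le_card_of_surjective _ Quotient.mk_surjective

end

/-! ### Assembling the local zeta function -/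

theorem properLocalTerm_eq {V : Type*} [AddCommGroup V] [Module ℚ V] (Q : QuadraticForm ℚ V)
    (L : Submodule ℤ V) (p : ℕ) (s : ℂ) (i : ℕ) :
    properLocalTerm Q L p s i = (properClassCount Q L (p ^ i) : ℂ) * ((p : ℂ) ^ (-s)) ^ i := by
  rw [properLocalTerm, ← Complex.cpow_nat_mul, mul_neg]

theorem norm_natCast_cpow_lt_one {p : ℕ} (hp : 1 < p) {s : ℂ} (hs : s.re < 0) :
    ‖(p : ℂ) ^ s‖ < 1 := by
  rw [Complex.norm_natCast_cpow_of_pos (by omega)]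
  exact Real.rpow_lt_one_of_one_lt_of_neg (by exact_mod_cast hp) hs

theorem mainTheorem8
    {F : Type*} [Field F] [NumberField F] [Algebra.IsQuadraticExtension ℚ F]
    [NumberField.IsTotallyComplex F]
    {V : Type*} [AddCommGroup V] [Module ℚ V]
    (Q : QuadraticForm ℚ V) (hQ : Q.PosDef)
    (e : Module.Basis (Fin 2) ℚ V)
    (L : Submodule ℤ V) (hL : L = Submodule.span ℤ (Set.range e))
    (hint : ∀ x ∈ L, ∃ n : ℤ, Q x = (n : ℚ))
    (hdisc : -4 * (gramMatrix Q e).det = (NumberField.discr F : ℚ))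
    (hunits : Nat.card (NumberField.RingOfIntegers F)ˣ = 2)
    (p : ℕ) (hp : p.Prime) (s : ℂ) (hs : 1 < s.re) :
    Summable (properLocalTerm Q L p s) ∧
    (IsInertIn F p ∨ IsRamifiedIn F p →
      properLocalZeta Q L p s =
        (1 - (p : ℂ) ^ (-s))⁻¹ * (1 - (p : ℂ) ^ (1 - s))⁻¹) ∧
    (IsSplitIn F p →
      ∀ 𝔭 : nonZeroDivisors (Ideal (NumberField.RingOfIntegers F)),
        (𝔭 : Ideal (NumberField.RingOfIntegers F)).IsPrime →
        (p : NumberField.RingOfIntegers F) ∈ (𝔭 : Ideal (NumberField.RingOfIntegers F)) →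
        properLocalZeta Q L p s =
          (1 - (p : ℂ) ^ (-((orderOf (ClassGroup.mk0 𝔭 ^ 2) : ℂ) * s))) *
            (1 - (p : ℂ) ^ (-s))⁻¹ * (1 - (p : ℂ) ^ (1 - s))⁻¹) := by
  subst hL
  obtain ⟨φ, I, hI, hmap, hpos, hφ⟩ := exists_ideal_model (F := F) Q hQ e hint hdisc
  have hcard := properClassCount_eq_card Q φ _ _ hmap hφ
  set L := Submodule.span ℤ (Set.range e)
  have hp0 : (p : ℂ) ≠ 0 := Nat.cast_ne_zero.2 hp.ne_zero
  set x : ℂ := (p : ℂ) ^ (-s) with hx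
  have hpx : (p : ℂ) ^ (1 - s) = p * x := by
    rw [sub_eq_add_neg, Complex.cpow_add _ _ hp0, Complex.cpow_one]
  have hx1 : ‖x‖ < 1 := norm_natCast_cpow_lt_one hp.one_lt (by simp; linarith)
  have hpx1 : ‖(p : ℂ) * x‖ < 1 := by
    rw [← hpx]
    exact norm_natCast_cpow_lt_one hp.one_lt (by simpa using hs)
  have hterm : properLocalTerm Q L p s =
      fun i => (properClassCount Q L (p ^ i) : ℂ) * x ^ i :=
    funext fun i => properLocalTerm_eq Q L p s i
  have hgeom := hasSum_geom_sum_mul_pow hx1 hpx1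
  rw [properLocalZeta, hterm, hpx]
  refine ⟨?_, ?_, ?_⟩
  -- There are at most as many classes as subgroups, so the series of all subgroups dominates.
  · refine Summable.of_norm_bounded (summable_norm_geom_sum_mul_pow hx1 hpx1) fun i => ?_
    rw [norm_mul, norm_mul]
    refine mul_le_mul_of_nonneg_right ?_ (norm_nonneg _)
    have := card_normOneSetoid_le hI hp i
    rw [← hcard] at this
    have hcast : ∑ k ∈ Finset.range (i + 1), (p : ℂ) ^ k =
        ((∑ k ∈ Finset.range (i + 1), p ^ k : ℕ) : ℂ) := by push_cast; rfl
    rw [hcast, Complex.norm_natCast, Complex.norm_natCast]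
    exact_mod_cast this
  · intro h
    obtain ⟨𝔭, k, h𝔭, hk⟩ : ∃ (𝔭 : Ideal (𝓞 F)) (k : ℕ), 𝔭.IsPrime ∧
        Ideal.span {(p : 𝓞 F)} = 𝔭 ^ k := by
      rcases h with h | ⟨𝔭, h𝔭, h⟩
      · exact ⟨_, 1, h, (pow_one _).symm⟩
      · exact ⟨𝔭, 2, h𝔭, h⟩
    rw [← hgeom.tsum_eq]
    refine tsum_congr fun i => ?_
    rw [hcard, card_normOneSetoid_of_span_eq_pow hunits hI hp h𝔭 hk]
    push_cast
    rfl
  · rintro ⟨𝔭₁, 𝔭₂, h₁, h₂, hne, hspan⟩ 𝔭 h𝔭 hp𝔭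
    have hspan0 : Ideal.span {(p : 𝓞 F)} ≠ 0 := by
      rw [Ideal.zero_eq_bot, Ne, Ideal.span_singleton_eq_bot]
      exact Nat.cast_ne_zero.2 hp.ne_zero
    -- The given `𝔭` contains `𝔭₁𝔭₂`, hence equals one of the two factors by maximality; `𝔮` is the
    -- other.
    obtain ⟨𝔮, h𝔮, hne', hspan'⟩ : ∃ 𝔮 : (Ideal (𝓞 F))⁰, 𝔮.1.IsPrime ∧ 𝔭.1 ≠ 𝔮.1 ∧
        Ideal.span {(p : 𝓞 F)} = 𝔭.1 * 𝔮.1 := by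
      have h₁0 : 𝔭₁ ≠ 0 := fun h => hspan0 (by rw [hspan, h, zero_mul])
      have h₂0 : 𝔭₂ ≠ 0 := fun h => hspan0 (by rw [hspan, h, mul_zero])
      have hle : 𝔭₁ * 𝔭₂ ≤ 𝔭.1 := hspan ▸ (Ideal.span_singleton_le_iff_mem _).2 hp𝔭
      rcases (h𝔭.mul_le).1 hle with h | h
      · have := (h₁.isMaximal h₁0).eq_of_le h𝔭.ne_top h
        subst this
        exact ⟨⟨𝔭₂, mem_nonZeroDivisors_of_ne_zero h₂0⟩, h₂, hne, hspan⟩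
      · have := (h₂.isMaximal h₂0).eq_of_le h𝔭.ne_top h
        subst this
        exact ⟨⟨𝔭₁, mem_nonZeroDivisors_of_ne_zero h₁0⟩, h₁, hne.symm, by rw [hspan, mul_comm]⟩
    have hxk : (p : ℂ) ^ (-((orderOf (ClassGroup.mk0 𝔭 ^ 2) : ℂ) * s)) =
        x ^ orderOf (ClassGroup.mk0 𝔭 ^ 2) := by
      rw [hx, ← Complex.cpow_nat_mul, mul_neg]
    rw [hxk, mul_assoc]
    refine (hasSum_sub_shift _ hgeom fun i => ?_).tsum_eq
    rw [eq_sub_iff_add_eq]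
    have := card_normOneSetoid_of_split hunits hpos hI hp h𝔭 h𝔮 hne' hspan' i
    rw [← hcard] at this
    exact_mod_cast this
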